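/- Let $\Omega\subseteq\mathbb R^2$ be a nonempty open set and let $F$ be a differential field of (real- or complex-valued) functions in the plane with common domain $\Omega$: its elements are functions that are smooth on dense open subsets of $\Omega$ (functions agreeing on a dense open subset of $\Omega$ are identified), and $F$ is a field closed under $\partial_x$ and $\partial_y$. A function $a\in F$ is said to depend on $x$ alone if $\partial_y a=0$; assume that $F$ contains a function of $x$ alone that is not constant, i.e. some $a$ with $\partial_y a=0$, $\partial_x a\neq 0$. Let $D=d/dx$. Operators $L(x,y)=\sum_i a_i(x,y)D^i$ have coefficients in $F$; operators written $R(x)$ have coefficients in $F$ depending on $x$ alone. An Euler multiintegral is an expression $\mathcal J=L_1(x,y)\varphi_1(x)+\dots+L_k(x,y)\varphi_k(x)$, $k\ge 1$, with arbitrary smooth functions $\varphi_j$; it is given by its operator row $(L_1,\dots,L_k)$. The multiintegral is operator-reducible if $(L_1,\dots,L_k)=(M_1,\dots,M_p)\widehat R(x)$ for some $p\le k$, some operators $M_i(x,y)$ and some $p\times k$ matrix $\widehat R(x)$ of operators with coefficients depending on $x$ alone that is not invertible (has no two-sided inverse matrix of operators of the same kind); otherwise it is operator-irreducible. It is kernel-irreducible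 if $\sum_j L_j(x,y)\varphi_j(x)=0$, with $\varphi_j$ smooth on the projection of $\Omega$ to the $x$-axis, implies that all $\varphi_j$ vanish there. The admissible operations on $(\varphi_1,\dots,\varphi_k)$ and their effect on the operator row are: interchanging $\varphi_i$ and $\varphi_j$ (interchange $L_i$ and $L_j$); multiplying $\varphi_i$ by a nonzero $g(x)\in F$ (replace $L_i$ by $L_i\,g$); replacing $\varphi_j$ by $\varphi_j+A(x)\varphi_i$, $i\ne j$, where $A(x)$ is an operator with coefficients depending on $x$ alone (replace $L_i$ by $L_i+L_jA$). Theorem. By finitely many admissible operations followed by dropping some zero components, the operator row of any multiintegral can be brought to the form $$\big(\widetilde L_1(x,y),\dots,\widetilde L_{p-1}(x,y),\ \widetilde M_p(x,y)\widetilde R(x)\big),\qquad p\ge 1,$$ where the row $(\widetilde L_1,\dots,\widetilde L_{p-1},\widetilde M_p)$ defines a multiintegral that is both operator-irreducible and kernel-irreducible, and where $\widetilde R(x)\neq 0$ unless all $L_j$ are zero. -/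

import Mathlib

open scoped ContDiff Matrix

/-! ### Functions in the plane, defined on a dense open part of a domain -/

/-- `V` is an open subset of the domain `Ω` that is dense in `Ω`. -/
def IsDenseOpenIn (Ω : TopologicalSpace.Opens (ℝ × ℝ)) (V : Set (ℝ × ℝ)) : Prop :=
  IsOpen V ∧ V ⊆ Ω ∧ (Ω : Set (ℝ × ℝ)) ⊆ closure V

theorem IsDenseOpenIn.inter {Ω : TopologicalSpace.Opens (ℝ × ℝ)} {V W : Set (ℝ × ℝ)}
    (hV : IsDenseOpenIn Ω V) (hW : IsDenseOpenIn Ω W) : IsDenseOpenIn Ω (V ∩ W) := by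
  refine ⟨hV.1.inter hW.1, fun z hz => hV.2.1 hz.1, fun z hz => ?_⟩
  rw [mem_closure_iff]
  intro N hN hzN
  obtain ⟨w, hwN, hwV⟩ := mem_closure_iff.1 (hV.2.2 hz) N hN hzN
  obtain ⟨v, hv, hvW⟩ :=
    mem_closure_iff.1 (hW.2.2 (hV.2.1 hwV)) (N ∩ V) (hN.inter hV.1) ⟨hwN, hwV⟩
  exact ⟨v, hv.1, hv.2, hvW⟩

/-- The filter of sets containing a dense open part of `Ω`. -/
def genericFilter (Ω : TopologicalSpace.Opens (ℝ × ℝ)) : Filter (ℝ × ℝ) where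
  sets := {S | ∃ V, IsDenseOpenIn Ω V ∧ V ⊆ S}
  univ_sets := ⟨Ω, ⟨Ω.isOpen, subset_rfl, subset_closure⟩, Set.subset_univ _⟩
  sets_of_superset := fun ⟨V, hV, hVS⟩ hST => ⟨V, hV, hVS.trans hST⟩
  inter_sets := fun ⟨V, hV, hVS⟩ ⟨W, hW, hWT⟩ =>
    ⟨V ∩ W, hV.inter hW, Set.inter_subset_inter hVS hWT⟩

theorem mem_genericFilter {Ω : TopologicalSpace.Opens (ℝ × ℝ)} {S : Set (ℝ × ℝ)} :
    S ∈ genericFilter Ω ↔ ∃ V, IsDenseOpenIn Ω V ∧ V ⊆ S := Iff.rfl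

/-- Functions on `Ω`, two functions being identified when they agree on a dense open subset of
`Ω` (so that, for example, a rational function is such a function, whatever its poles). -/
abbrev GenericFunction (𝕜 : Type) [RCLike 𝕜] (Ω : TopologicalSpace.Opens (ℝ × ℝ)) : Type :=
  Filter.Germ (genericFilter Ω) 𝕜

section GenericFunction

variable {𝕜 : Type} [RCLike 𝕜] {Ω : TopologicalSpace.Opens (ℝ × ℝ)}

/-- `f` is (represented by) a smooth function on a dense open subset of `Ω`. -/
def GenericFunction.IsSmooth (f : GenericFunction 𝕜 Ω) : Prop :=
  ∃ (u : ℝ × ℝ → 𝕜) (V : Set (ℝ × ℝ)),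
    IsDenseOpenIn Ω V ∧ ContDiffOn ℝ ∞ u V ∧ (u : GenericFunction 𝕜 Ω) = f

/-- The derivative in the direction `w`. -/
noncomputable def GenericFunction.dirDeriv (w : ℝ × ℝ) :
    GenericFunction 𝕜 Ω → GenericFunction 𝕜 Ω :=
  Filter.Germ.map' (fun u z => lineDeriv ℝ u z w) (by
    intro u v huv
    obtain ⟨V, hV, hVS⟩ := mem_genericFilter.1 huv
    refine mem_genericFilter.2 ⟨V, hV, fun z hz => ?_⟩
    have h : u =ᶠ[nhds z] v := by
      filter_upwards [hV.1.mem_nhds hz] with z' hz' using hVS hz'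
    exact h.lineDeriv_eq)

/-- `∂/∂x`. -/
noncomputable def GenericFunction.partialX : GenericFunction 𝕜 Ω → GenericFunction 𝕜 Ω :=
  GenericFunction.dirDeriv (1, 0)

/-- `∂/∂y`. -/
noncomputable def GenericFunction.partialY : GenericFunction 𝕜 Ω → GenericFunction 𝕜 Ω :=
  GenericFunction.dirDeriv (0, 1)

theorem GenericFunction.dirDeriv_add (w : ℝ × ℝ) {f g : GenericFunction 𝕜 Ω}
    (hf : f.IsSmooth) (hg : g.IsSmooth) :
    dirDeriv w (f + g) = dirDeriv w f + dirDeriv w g := by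
  obtain ⟨u, V, hV, hu, rfl⟩ := hf
  obtain ⟨v, W, hW, hv, rfl⟩ := hg
  refine Filter.Germ.coe_eq.2 (mem_genericFilter.2 ⟨V ∩ W, hV.inter hW, fun z hz => ?_⟩)
  have h1 : DifferentiableAt ℝ u z :=
    (hu.contDiffAt (hV.1.mem_nhds hz.1)).differentiableAt (by simp)
  have h2 : DifferentiableAt ℝ v z :=
    (hv.contDiffAt (hW.1.mem_nhds hz.2)).differentiableAt (by simp)
  change lineDeriv ℝ (u + v) z w = lineDeriv ℝ u z w + lineDeriv ℝ v z w
  rw [(h1.add h2).lineDeriv_eq_fderiv, h1.lineDeriv_eq_fderiv, h2.lineDeriv_eq_fderiv,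
    fderiv_add h1 h2]
  rfl

theorem GenericFunction.dirDeriv_mul (w : ℝ × ℝ) {f g : GenericFunction 𝕜 Ω}
    (hf : f.IsSmooth) (hg : g.IsSmooth) :
    dirDeriv w (f * g) = f * dirDeriv w g + g * dirDeriv w f := by
  obtain ⟨u, V, hV, hu, rfl⟩ := hf
  obtain ⟨v, W, hW, hv, rfl⟩ := hg
  refine Filter.Germ.coe_eq.2 (mem_genericFilter.2 ⟨V ∩ W, hV.inter hW, fun z hz => ?_⟩)
  have h1 : DifferentiableAt ℝ u z :=
    (hu.contDiffAt (hV.1.mem_nhds hz.1)).differentiableAt (by simp)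
  have h2 : DifferentiableAt ℝ v z :=
    (hv.contDiffAt (hW.1.mem_nhds hz.2)).differentiableAt (by simp)
  change lineDeriv ℝ (u * v) z w = u z * lineDeriv ℝ v z w + v z * lineDeriv ℝ u z w
  rw [(h1.mul h2).lineDeriv_eq_fderiv, h1.lineDeriv_eq_fderiv, h2.lineDeriv_eq_fderiv,
    fderiv_mul h1 h2]
  simp

end GenericFunction

/-- A differential field of functions in the plane with common domain `Ω`: a set of functions,
smooth on dense open subsets of `Ω`, closed under ring operations, under both partial derivatives
and under inversion of the nonzero elements. -/
structure PlaneFunctionField (𝕜 : Type) [RCLike 𝕜] (Ω : TopologicalSpace.Opens (ℝ × ℝ))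
    extends Subring (GenericFunction 𝕜 Ω) where
  smooth' : ∀ f ∈ carrier, f.IsSmooth
  partialX_mem' : ∀ f ∈ carrier, f.partialX ∈ carrier
  partialY_mem' : ∀ f ∈ carrier, f.partialY ∈ carrier
  inv_mem' : ∀ f ∈ carrier, f ≠ 0 → ∃ g ∈ carrier, f * g = 1

namespace PlaneFunctionField

variable {𝕜 : Type} [RCLike 𝕜] {Ω : TopologicalSpace.Opens (ℝ × ℝ)}

/-- The elements of the field, as a type (a commutative ring). -/
abbrev Elem (F : PlaneFunctionField 𝕜 Ω) : Type := F.toSubring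

/-- `∂/∂x` as a derivation of the field. -/
noncomputable def dx (F : PlaneFunctionField 𝕜 Ω) : Derivation ℤ F.Elem F.Elem :=
  Derivation.mk'
    (AddMonoidHom.mk' (fun f : F.Elem => (⟨f.1.partialX, F.partialX_mem' _ f.2⟩ : F.Elem))
      (fun f g => Subtype.ext
        (GenericFunction.dirDeriv_add _ (F.smooth' _ f.2) (F.smooth' _ g.2)))).toIntLinearMap
    (fun f g => Subtype.ext
      (GenericFunction.dirDeriv_mul _ (F.smooth' _ f.2) (F.smooth' _ g.2)))

/-- `∂/∂y` as a derivation of the field. -/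
noncomputable def dy (F : PlaneFunctionField 𝕜 Ω) : Derivation ℤ F.Elem F.Elem :=
  Derivation.mk'
    (AddMonoidHom.mk' (fun f : F.Elem => (⟨f.1.partialY, F.partialY_mem' _ f.2⟩ : F.Elem))
      (fun f g => Subtype.ext
        (GenericFunction.dirDeriv_add _ (F.smooth' _ f.2) (F.smooth' _ g.2)))).toIntLinearMap
    (fun f g => Subtype.ext
      (GenericFunction.dirDeriv_mul _ (F.smooth' _ f.2) (F.smooth' _ g.2)))

end PlaneFunctionField

/-! ### The ring of linear ordinary differential operators -/

/-- Linear ordinary differential operators `a₀ + a₁ D + ⋯ + aₙ Dⁿ` over a commutative ring `A`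
with a derivation `δ`, given by their coefficient sequences `i ↦ aᵢ`. -/
def LODO {A : Type} [CommRing A] (_δ : Derivation ℤ A A) : Type := ℕ →₀ A

namespace LODO

variable {A : Type} [CommRing A] {δ : Derivation ℤ A A}

noncomputable instance : AddCommGroup (LODO δ) := inferInstanceAs (AddCommGroup (ℕ →₀ A))

noncomputable instance : Module A (LODO δ) := inferInstanceAs (Module A (ℕ →₀ A))

/-- The coefficient of `Dⁱ`. -/
def coeff (P : LODO δ) (i : ℕ) : A := (show ℕ →₀ A from P) i

/-- The operator `a Dⁱ`. -/
noncomputable def monomial (i : ℕ) (a : A) : LODO δ := (Finsupp.single i a : ℕ →₀ A)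

/-- The operator of order zero "multiplication by `a`". -/
noncomputable def C (a : A) : LODO δ := monomial 0 a

/-- Composition with `D` on the left: `D ∘ ∑ bⱼ Dʲ = ∑ (δ(bⱼ) Dʲ + bⱼ Dʲ⁺¹)`. -/
noncomputable def leftD : LODO δ →+ LODO δ :=
  Finsupp.liftAddHom fun j =>
    AddMonoidHom.mk' (fun b => (monomial j (δ b) + monomial (j + 1) b : LODO δ)) (by
      intro a b
      simp only [monomial, map_add, Finsupp.single_add]
      exact add_add_add_comm _ _ _ _)

/-- Composition of operators: `(∑ aᵢ Dⁱ) ∘ Q = ∑ aᵢ · (D ∘ ⋯ ∘ D ∘ Q)`. -/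
noncomputable instance : Mul (LODO δ) :=
  ⟨fun P Q => Finsupp.sum (show ℕ →₀ A from P) fun i a => a • (leftD^[i] Q)⟩

noncomputable instance : One (LODO δ) := ⟨C 1⟩

theorem leftD_monomial (j : ℕ) (b : A) :
    leftD (monomial j b : LODO δ) = monomial j (δ b) + monomial (j + 1) b := by
  unfold leftD
  exact Finsupp.liftAddHom_apply_single _ _ _

theorem monomial_mul (i : ℕ) (a : A) (Q : LODO δ) :
    monomial i a * Q = a • (leftD^[i] Q) :=
  Finsupp.sum_single_index (zero_smul A _)

theorem add_mul' (P Q R : LODO δ) : (P + Q) * R = P * R + Q * R :=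
  Finsupp.sum_add_index' (fun _ => zero_smul A _) (fun _ _ _ => add_smul _ _ _)

theorem mul_add' (P Q R : LODO δ) : P * (Q + R) = P * Q + P * R := by
  refine Eq.trans ?_ Finsupp.sum_add
  refine Finsupp.sum_congr fun i _ => ?_
  rw [iterate_map_add, smul_add]

theorem induction {p : LODO δ → Prop} (P : LODO δ) (h0 : p 0)
    (hadd : ∀ P Q, p P → p Q → p (P + Q)) (hm : ∀ i a, p (monomial i a)) : p P :=
  Finsupp.induction_linear (motive := p) P h0 hadd hm

theorem zero_mul' (P : LODO δ) : 0 * P = 0 := Finsupp.sum_zero_index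

theorem mul_zero' (P : LODO δ) : P * 0 = 0 := by
  have h := mul_add' P 0 0
  rw [add_zero] at h
  exact left_eq_add.1 h

theorem smul_monomial (a b : A) (j : ℕ) :
    a • (monomial j b : LODO δ) = monomial j (a * b) :=
  Finsupp.smul_single a j b

theorem monomial_add (i : ℕ) (a b : A) :
    (monomial i (a + b) : LODO δ) = monomial i a + monomial i b :=
  Finsupp.single_add i a b

theorem leftD_smul (a : A) (Q : LODO δ) : leftD (a • Q) = δ a • Q + a • leftD Q := by
  induction Q using LODO.induction with
  | h0 => simp
  | hadd P Q hP hQ => rw [smul_add, map_add, hP, hQ, map_add, smul_add, smul_add]; abel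
  | hm j b =>
    rw [smul_monomial, leftD_monomial, leftD_monomial, smul_add, smul_monomial, smul_monomial,
      smul_monomial, Derivation.leibniz, monomial_add, smul_eq_mul, smul_eq_mul, mul_comm b]
    abel

theorem smul_mul' (a : A) (P Q : LODO δ) : (a • P) * Q = a • (P * Q) := by
  induction P using LODO.induction with
  | h0 => simp [zero_mul']
  | hadd P R hP hR => rw [smul_add, add_mul', hP, hR, add_mul', smul_add]
  | hm j b => rw [smul_monomial, monomial_mul, monomial_mul, mul_smul]

theorem leftD_mul (P Q : LODO δ) : leftD P * Q = leftD (P * Q) := by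
  induction P using LODO.induction with
  | h0 => simp [zero_mul']
  | hadd P R hP hR => rw [map_add, add_mul', hP, hR, add_mul', map_add]
  | hm j b =>
    rw [leftD_monomial, add_mul', monomial_mul, monomial_mul, monomial_mul, leftD_smul,
      Function.iterate_succ_apply']

theorem leftD_iterate_mul (i : ℕ) (P Q : LODO δ) : leftD^[i] P * Q = leftD^[i] (P * Q) := by
  induction i with
  | zero => rfl
  | succ n ih => rw [Function.iterate_succ_apply', leftD_mul, ih, Function.iterate_succ_apply']

theorem mul_assoc' (P Q R : LODO δ) : P * Q * R = P * (Q * R) := by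
  induction P using LODO.induction with
  | h0 => simp [zero_mul']
  | hadd P S hP hS => rw [add_mul', add_mul', hP, hS, add_mul']
  | hm i a => rw [monomial_mul, smul_mul', leftD_iterate_mul, monomial_mul]

theorem one_mul' (P : LODO δ) : 1 * P = P :=
  (monomial_mul 0 1 P).trans (one_smul A P)

theorem leftD_iterate_one (i : ℕ) : leftD^[i] (1 : LODO δ) = monomial i 1 := by
  induction i with
  | zero => rfl
  | succ n ih =>
    have h : (monomial n 0 : LODO δ) = 0 := Finsupp.single_zero n
    rw [Function.iterate_succ_apply', ih, leftD_monomial, Derivation.map_one_eq_zero, h, zero_add]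

theorem mul_one' (P : LODO δ) : P * 1 = P := by
  induction P using LODO.induction with
  | h0 => exact zero_mul' _
  | hadd P Q hP hQ => rw [add_mul', hP, hQ]
  | hm i a => rw [monomial_mul, leftD_iterate_one, smul_monomial, mul_one]

noncomputable instance : Ring (LODO δ) :=
  { (inferInstance : AddCommGroup (LODO δ)) with
    mul := (· * ·)
    one := 1
    mul_assoc := mul_assoc'
    one_mul := one_mul'
    mul_one := mul_one'
    left_distrib := mul_add'
    right_distrib := add_mul'
    zero_mul := zero_mul'
    mul_zero := mul_zero'
    zsmul := (· • ·)
    zsmul_zero' := zero_zsmul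
    zsmul_succ' := fun n a => by
      simpa using SubNegMonoid.zsmul_succ' n a
    zsmul_neg' := fun n a => SubNegMonoid.zsmul_neg' n a
    nsmul := (· • ·)
    nsmul_zero := zero_nsmul
    nsmul_succ := fun n a => succ_nsmul a n }

/-- The commutation rule `D ∘ a = a D + δ(a)`. -/
theorem monomial_one_mul_C (a : A) :
    (monomial 1 1 * C a : LODO δ) = monomial 1 a + C (δ a) := by
  rw [monomial_mul, one_smul, add_comm]
  exact leftD_monomial 0 a

end LODO

/-! ### Euler multiintegrals -/

namespace PlaneFunctionField

variable {𝕜 : Type} [RCLike 𝕜] {Ω : TopologicalSpace.Opens (ℝ × ℝ)}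

/-- Operators `L(x,y)` with coefficients in the field `F`, including derivatives in `x` only. -/
abbrev Op (F : PlaneFunctionField 𝕜 Ω) : Type := LODO F.dx

variable {F : PlaneFunctionField 𝕜 Ω}

/-- The coefficients of the operator depend on `x` alone, that is, they do not vary with `y`:
`∂aᵢ/∂y = 0`. -/
def XOnly (P : F.Op) : Prop := ∀ i, F.dy (P.coeff i) = 0

/-- The function `L(x,y) φ(x) = ∑ᵢ aᵢ(x,y) φ⁽ⁱ⁾(x)`. -/
noncomputable def apply (L : F.Op) (φ : ℝ → 𝕜) : GenericFunction 𝕜 Ω :=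
  Finsupp.sum (show ℕ →₀ F.Elem from L) fun i a =>
    (a : GenericFunction 𝕜 Ω) *
      ((fun z : ℝ × ℝ => iteratedDeriv i φ z.1 : ℝ × ℝ → 𝕜) : GenericFunction 𝕜 Ω)

/-- The matrix `R(x)` of operators is invertible: it has a two-sided inverse which is a matrix
of operators with coefficients depending on `x` alone. -/
def MatrixInvertible {p k : ℕ} (R : Matrix (Fin p) (Fin k) F.Op) : Prop :=
  ∃ S : Matrix (Fin k) (Fin p) F.Op, (∀ i j, XOnly (S i j)) ∧ R * S = 1 ∧ S * R = 1

/-- Operator-reducibility of the multiintegral with operator row `L = (L₁, …, L_k)`: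
`L = M R` with a row `M` of length `p ≤ k` and a non-invertible `p × k` matrix `R(x)`. -/
def OperatorReducible {k : ℕ} (L : Fin k → F.Op) : Prop :=
  ∃ p ≤ k, ∃ (M : Fin p → F.Op) (R : Matrix (Fin p) (Fin k) F.Op),
    (∀ i j, XOnly (R i j)) ∧ ¬ MatrixInvertible R ∧ L = M ᵥ* R

/-- Kernel-irreducibility: `L₁ φ₁ + ⋯ + L_k φ_k` vanishes, for smooth functions `φⱼ` of `x` on
the projection of `Ω`, only if all `φⱼ` vanish there. -/
def KernelIrreducible {k : ℕ} (L : Fin k → F.Op) : Prop :=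
  ∀ φ : Fin k → ℝ → 𝕜, (∀ j, ContDiffOn ℝ ∞ (φ j) (Prod.fst '' (Ω : Set (ℝ × ℝ)))) →
    ∑ j, apply (L j) (φ j) = 0 →
    ∀ j, ∀ x ∈ Prod.fst '' (Ω : Set (ℝ × ℝ)), φ j x = 0

/-- One admissible operation with the arbitrary functions, written as its effect on the operator
row: `φᵢ ↔ φⱼ`, `φᵢ ↦ g(x) φᵢ`, `φⱼ ↦ φⱼ + A(x) φᵢ`. -/
inductive AdmissibleStep {k : ℕ} : (Fin k → F.Op) → (Fin k → F.Op) → Prop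
  | swap (L : Fin k → F.Op) (i j : Fin k) : AdmissibleStep L (L ∘ Equiv.swap i j)
  | scale (L : Fin k → F.Op) (i : Fin k) (g : F.Elem) (hg : g ≠ 0) (hx : F.dy g = 0) :
      AdmissibleStep L (Function.update L i (L i * LODO.C g))
  | add (L : Fin k → F.Op) (i j : Fin k) (hij : i ≠ j) (A : F.Op) (hA : XOnly A) :
      AdmissibleStep L (Function.update L i (L i + L j * A))

/-- `N` is obtained from `L` by dropping some zero components. -/
def DropZeros {k p : ℕ} (L : Fin k → F.Op) (N : Fin p → F.Op) : Prop :=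
  ∃ e : Fin p ↪o Fin k, (∀ i, N i = L (e i)) ∧ ∀ j, j ∉ Set.range e → L j = 0

end PlaneFunctionField

/-! Let `K` be the field of functions of `x` alone in `F`, and let `R = K[D]`. The ring `F[D]` is a
right `R`-module, and a `K`-basis of `F` makes it free; its coordinates are right `R`-linear
functionals `F[D] → R`. Everything rests on such functionals, because admissible operations only
form right `R`-combinations of the components.

If a row `M` has a dual system, meaning functionals with `f i (M j) = δ_ij`, it is irreducible in
both senses. A factorization `M = N R̂` gives `(f i (N r)) R̂ = 1`, and over `R̂` with at most as
many rows as columns this left inverse is two-sided. A relation `∑ M j φ j = 0` splits, along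
multipliers independent over `K`, into relations with coefficients in `R`; applying the functionals
to these isolates each `φ i`.

To reach such a row, choose a reachable row with first component `v`, and a functional `f`, such
that `d = f v ≠ 0` has least order. Division with remainder then makes `f` vanish on the other
components, and shows that `d` right-divides `g v` for every functional `g`. If the other components
are zero, `v = P d` and `f P = 1`: this is the last component, with `R̃ = d`. Otherwise some `g (T
j) = q` is nonzero, and perturbing `f` by multiples of `g - c f`, which kills `v`, shows that `d R`
contains `R q`. Since `R` is simple (this uses a nonconstant function of `x`), `d` is invertible, so
`v` splits off and the argument recurs on the remaining components. -/

namespace LODO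

variable {A : Type} [CommRing A] {δ : Derivation ℤ A A}

/-! ### Coefficients of operators -/

theorem ext_coeff {P Q : LODO δ} (h : ∀ i, P.coeff i = Q.coeff i) : P = Q :=
  Finsupp.ext h

@[simp]
theorem coeff_zero (i : ℕ) : (0 : LODO δ).coeff i = 0 := rfl

@[simp]
theorem coeff_add (P Q : LODO δ) (i : ℕ) : (P + Q).coeff i = P.coeff i + Q.coeff i := rfl

@[simp]
theorem coeff_sub (P Q : LODO δ) (i : ℕ) : (P - Q).coeff i = P.coeff i - Q.coeff i := rfl

@[simp]
theorem coeff_neg (P : LODO δ) (i : ℕ) : (-P).coeff i = -P.coeff i := rfl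

@[simp]
theorem coeff_smul (a : A) (P : LODO δ) (i : ℕ) : (a • P).coeff i = a * P.coeff i := rfl

theorem coeff_monomial (i j : ℕ) (a : A) :
    (monomial i a : LODO δ).coeff j = if i = j then a else 0 :=
  Finsupp.single_apply

theorem coeff_C_zero (a : A) : (C a : LODO δ).coeff 0 = a := by
  simp [C, coeff_monomial]

/-- Taking the coefficient of `Dⁱ`, as an additive map. -/
def coeffHom (δ : Derivation ℤ A A) (i : ℕ) : LODO δ →+ A where
  toFun P := P.coeff i
  map_zero' := rfl
  map_add' _ _ := rfl

theorem coeff_sum {ι : Type*} (s : Finset ι) (f : ι → LODO δ) (i : ℕ) :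
    (∑ j ∈ s, f j).coeff i = ∑ j ∈ s, (f j).coeff i :=
  map_sum (coeffHom δ i) f s

theorem C_mul (a : A) (P : LODO δ) : C a * P = a • P :=
  monomial_mul 0 a P

theorem mul_eq_sum (P Q : LODO δ) :
    P * Q = ∑ i ∈ (show ℕ →₀ A from P).support, P.coeff i • leftD^[i] Q := rfl

theorem coeff_leftD_zero (P : LODO δ) : (leftD P).coeff 0 = δ (P.coeff 0) := by
  induction P using LODO.induction with
  | h0 => simp
  | hadd P Q hP hQ => simp [hP, hQ]
  | hm i a => rw [leftD_monomial, coeff_add]; simp only [coeff_monomial]; split_ifs <;> simp_all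

theorem coeff_leftD_succ (P : LODO δ) (j : ℕ) :
    (leftD P).coeff (j + 1) = δ (P.coeff (j + 1)) + P.coeff j := by
  induction P using LODO.induction with
  | h0 => simp
  | hadd P Q hP hQ => simp only [map_add, coeff_add, hP, hQ]; abel
  | hm i a =>
    rw [leftD_monomial, coeff_add]; simp only [coeff_monomial]
    split_ifs <;> simp_all

/-! ### The order of an operator -/

/-- The operator has order less than `n`. -/
def OrderLT (P : LODO δ) (n : ℕ) : Prop := ∀ i, n ≤ i → P.coeff i = 0

theorem OrderLT.mono {P : LODO δ} {m n : ℕ} (h : P.OrderLT m) (hmn : m ≤ n) : P.OrderLT n :=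
  fun i hi => h i (hmn.trans hi)

theorem OrderLT.sub {P Q : LODO δ} {n : ℕ} (hP : P.OrderLT n) (hQ : Q.OrderLT n) :
    (P - Q).OrderLT n := fun i hi => by rw [coeff_sub, hP i hi, hQ i hi, sub_zero]

theorem orderLT_zero {P : LODO δ} : P.OrderLT 0 ↔ P = 0 :=
  ⟨fun h => ext_coeff fun i => h i i.zero_le, fun h _ _ => h ▸ rfl⟩

theorem OrderLT.of_succ {P : LODO δ} {n : ℕ} (h : P.OrderLT (n + 1)) (h' : P.coeff n = 0) :
    P.OrderLT n := fun i hi => by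
  rcases hi.eq_or_lt with rfl | hi
  · exact h'
  · exact h i hi

theorem exists_orderLT (P : LODO δ) : ∃ n, P.OrderLT n := by
  refine ⟨(show ℕ →₀ A from P).support.sup id + 1, fun i hi => ?_⟩
  by_contra h
  exact absurd (Finset.le_sup (f := id) (Finsupp.mem_support_iff.2 h)) (not_le.2 hi)

theorem exists_order {P : LODO δ} (hP : P ≠ 0) : ∃ n, P.OrderLT (n + 1) ∧ P.coeff n ≠ 0 := by
  classical
  have h := P.exists_orderLT
  obtain ⟨n, hn⟩ : ∃ n, Nat.find h = n + 1 := by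
    refine Nat.exists_eq_succ_of_ne_zero fun h0 => hP (orderLT_zero.1 ?_)
    rw [← h0]
    exact Nat.find_spec h
  refine ⟨n, hn ▸ Nat.find_spec h, fun h0 => ?_⟩
  exact Nat.find_min h (m := n) (by omega) (OrderLT.of_succ (hn ▸ Nat.find_spec h) h0)

theorem orderLT_monomial (i : ℕ) (a : A) : (monomial i a : LODO δ).OrderLT (i + 1) :=
  fun j hj => by rw [coeff_monomial, if_neg (by omega)]

theorem OrderLT.leftD {P : LODO δ} {n : ℕ} (h : P.OrderLT n) : (leftD P).OrderLT (n + 1) := by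
  rintro (_ | i) hi
  · omega
  · rw [coeff_leftD_succ, h _ (by omega), h _ (by omega), map_zero, add_zero]

theorem OrderLT.leftD_iterate {P : LODO δ} {n : ℕ} (h : P.OrderLT n) (i : ℕ) :
    (LODO.leftD^[i] P).OrderLT (i + n) := by
  induction i with
  | zero => simpa using h
  | succ i ih =>
    rw [Function.iterate_succ_apply', show i + 1 + n = i + n + 1 by omega]
    exact ih.leftD

theorem OrderLT.coeff_leftD_iterate {P : LODO δ} {n : ℕ} (h : P.OrderLT (n + 1)) (i : ℕ) :
    (LODO.leftD^[i] P).coeff (i + n) = P.coeff n := by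
  induction i with
  | zero => simp
  | succ i ih =>
    rw [Function.iterate_succ_apply', show i + 1 + n = i + n + 1 by omega, coeff_leftD_succ, ih,
      h.leftD_iterate i _ (by omega), map_zero, zero_add]

theorem OrderLT.mul {P Q : LODO δ} {m n : ℕ} (hP : P.OrderLT (m + 1)) (hQ : Q.OrderLT (n + 1)) :
    (P * Q).OrderLT (m + n + 1) := by
  intro j hj
  rw [mul_eq_sum, coeff_sum]
  refine Finset.sum_eq_zero fun i _ => ?_
  rw [coeff_smul]
  rcases le_or_gt i m with h | h
  · rw [hQ.leftD_iterate i j (by omega), mul_zero]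
  · rw [hP i h, zero_mul]

/-- Applying `D` raises the order bound by one and keeps the leading coefficient, so only the
product of the leading terms reaches degree `m + n`. Over a domain this excludes zero divisors. -/
theorem OrderLT.coeff_mul {P Q : LODO δ} {m n : ℕ} (hP : P.OrderLT (m + 1))
    (hQ : Q.OrderLT (n + 1)) : (P * Q).coeff (m + n) = P.coeff m * Q.coeff n := by
  rw [mul_eq_sum, coeff_sum, Finset.sum_eq_single m]
  · rw [coeff_smul, hQ.coeff_leftD_iterate]
  · intro i _ hi
    rw [coeff_smul]
    rcases le_or_gt i m with h | h
    · rw [hQ.leftD_iterate i _ (by omega), mul_zero]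
    · rw [hP i h, zero_mul]
  · intro h
    rw [coeff_smul, show P.coeff m = 0 from Finsupp.notMem_support_iff.1 h, zero_mul]

theorem eq_zero_or_eq_zero_of_mul_eq_zero [IsDomain A] {P Q : LODO δ} (h : P * Q = 0) :
    P = 0 ∨ Q = 0 := by
  by_contra! hPQ
  obtain ⟨m, hm, hm'⟩ := exists_order hPQ.1
  obtain ⟨n, hn, hn'⟩ := exists_order hPQ.2
  have := hm.coeff_mul hn
  rw [h, coeff_zero] at this
  exact mul_ne_zero hm' hn' this.symm

instance [IsDomain A] : NoZeroDivisors (LODO δ) := ⟨eq_zero_or_eq_zero_of_mul_eq_zero⟩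

instance [Nontrivial A] : Nontrivial (LODO δ) :=
  ⟨0, 1, fun h => zero_ne_one (α := A) <| by
    rw [← coeff_C_zero (δ := δ) 1, ← coeff_zero (δ := δ) 0, h]; rfl⟩

/-! ### Operators with constant coefficients for a second derivation -/

/-- The coefficients of the operator are constants of the derivation `ε`. -/
def ConstCoeff (ε : Derivation ℤ A A) (P : LODO δ) : Prop := ∀ i, ε (P.coeff i) = 0

section ConstCoeff

variable {ε : Derivation ℤ A A}

theorem ConstCoeff.zero : ConstCoeff ε (0 : LODO δ) := fun _ => by simp

theorem ConstCoeff.add {P Q : LODO δ} (hP : ConstCoeff ε P) (hQ : ConstCoeff ε Q) :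
    ConstCoeff ε (P + Q) := fun i => by rw [coeff_add, map_add, hP, hQ, add_zero]

theorem ConstCoeff.neg {P : LODO δ} (hP : ConstCoeff ε P) : ConstCoeff ε (-P) :=
  fun i => by rw [coeff_neg, map_neg, hP, neg_zero]

theorem ConstCoeff.sub {P Q : LODO δ} (hP : ConstCoeff ε P) (hQ : ConstCoeff ε Q) :
    ConstCoeff ε (P - Q) := fun i => by rw [coeff_sub, map_sub, hP, hQ, sub_zero]

theorem ConstCoeff.smul {a : A} (ha : ε a = 0) {P : LODO δ} (hP : ConstCoeff ε P) :
    ConstCoeff ε (a • P) := fun i => by rw [coeff_smul, ε.leibniz, hP, ha]; simp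

theorem ConstCoeff.sum {ι : Type*} {s : Finset ι} {f : ι → LODO δ}
    (h : ∀ i ∈ s, ConstCoeff ε (f i)) : ConstCoeff ε (∑ i ∈ s, f i) := fun j => by
  rw [coeff_sum, map_sum]
  exact Finset.sum_eq_zero fun i hi => h i hi j

theorem ConstCoeff.monomial {a : A} (ha : ε a = 0) (i : ℕ) :
    ConstCoeff ε (monomial i a : LODO δ) := fun j => by
  rw [coeff_monomial]; split_ifs <;> simp [ha]

theorem ConstCoeff.C {a : A} (ha : ε a = 0) : ConstCoeff ε (C a : LODO δ) :=
  ConstCoeff.monomial ha 0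

theorem ConstCoeff.leftD (hc : ∀ a, ε (δ a) = δ (ε a)) {P : LODO δ} (hP : ConstCoeff ε P) :
    ConstCoeff ε (leftD P) := by
  rintro (_ | i)
  · rw [coeff_leftD_zero, hc, hP, map_zero]
  · rw [coeff_leftD_succ, map_add, hc, hP, hP, map_zero, add_zero]

theorem ConstCoeff.leftD_iterate (hc : ∀ a, ε (δ a) = δ (ε a)) {P : LODO δ}
    (hP : ConstCoeff ε P) (i : ℕ) : ConstCoeff ε (LODO.leftD^[i] P) := by
  induction i with
  | zero => exact hP
  | succ i ih => rw [Function.iterate_succ_apply']; exact ih.leftD hc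

theorem ConstCoeff.mul (hc : ∀ a, ε (δ a) = δ (ε a)) {P Q : LODO δ} (hP : ConstCoeff ε P)
    (hQ : ConstCoeff ε Q) : ConstCoeff ε (P * Q) := by
  rw [mul_eq_sum]
  exact ConstCoeff.sum fun i _ => (hQ.leftD_iterate hc i).smul (hP i)

theorem derivation_inv_eq_zero {a b : A} (hab : a * b = 1) (ha : ε a = 0) : ε b = 0 := by
  have h : ε (a * b) = 0 := by rw [hab, ε.map_one_eq_zero]
  rw [ε.leibniz, ha, smul_zero, add_zero, smul_eq_mul] at h
  calc ε b = b * (a * ε b) := by rw [← mul_assoc, mul_comm b, hab, one_mul]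
    _ = 0 := by rw [h, mul_zero]

/-- Division with remainder, the quotient standing on the right. -/
theorem exists_sub_mul_orderLT (hc : ∀ a, ε (δ a) = δ (ε a)) {d : LODO δ} (hd : ConstCoeff ε d)
    {m : ℕ} (hm : d.OrderLT (m + 1)) {b : A} (hb : d.coeff m * b = 1) {P : LODO δ}
    (hP : ConstCoeff ε P) : ∃ q, ConstCoeff ε q ∧ (P - d * q).OrderLT m := by
  obtain ⟨n, hn⟩ := P.exists_orderLT
  induction n generalizing P with
  | zero => exact ⟨0, ConstCoeff.zero, by simpa using hn.mono (Nat.zero_le m)⟩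
  | succ n ih =>
    rcases lt_or_ge n m with h | h
    · exact ⟨0, ConstCoeff.zero, by simpa using hn.mono h⟩
    obtain ⟨l, rfl⟩ := Nat.exists_eq_add_of_le h
    -- This monomial cancels the leading term of `P`. Its coefficient is an `ε`-constant because the
    -- inverse `b` of a constant is one.
    have hq : ConstCoeff ε (monomial l (b * P.coeff (m + l)) : LODO δ) :=
      ConstCoeff.monomial (by rw [ε.leibniz, derivation_inv_eq_zero hb (hd m), hP]; simp) l
    obtain ⟨q, hq1, hq2⟩ := ih (hP.sub (hd.mul hc hq)) (OrderLT.of_succ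
      (hn.sub (hm.mul (orderLT_monomial l _))) (by
        rw [coeff_sub, hm.coeff_mul (orderLT_monomial l _), coeff_monomial, if_pos rfl,
          ← mul_assoc, hb, one_mul, sub_self]))
    exact ⟨_, hq.add hq1, by rwa [mul_add, ← sub_sub]⟩

/-- Division with remainder, the quotient standing on the left. -/
theorem exists_sub_mul_orderLT' (hc : ∀ a, ε (δ a) = δ (ε a)) {d : LODO δ} (hd : ConstCoeff ε d)
    {m : ℕ} (hm : d.OrderLT (m + 1)) {b : A} (hb : d.coeff m * b = 1) {P : LODO δ}
    (hP : ConstCoeff ε P) : ∃ q, ConstCoeff ε q ∧ (P - q * d).OrderLT m := by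
  obtain ⟨n, hn⟩ := P.exists_orderLT
  induction n generalizing P with
  | zero => exact ⟨0, ConstCoeff.zero, by simpa using hn.mono (Nat.zero_le m)⟩
  | succ n ih =>
    rcases lt_or_ge n m with h | h
    · exact ⟨0, ConstCoeff.zero, by simpa using hn.mono h⟩
    obtain ⟨l, rfl⟩ := Nat.exists_eq_add_of_le' h
    have hq : ConstCoeff ε (monomial l (P.coeff (l + m) * b) : LODO δ) :=
      ConstCoeff.monomial (by rw [ε.leibniz, derivation_inv_eq_zero hb (hd m), hP]; simp) l
    obtain ⟨q, hq1, hq2⟩ := ih (hP.sub (hq.mul hc hd)) (OrderLT.of_succ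
      (hn.sub ((orderLT_monomial l _).mul hm)) (by
        rw [coeff_sub, (orderLT_monomial l _).coeff_mul hm, coeff_monomial, if_pos rfl,
          mul_assoc, mul_comm b, hb, mul_one, sub_self]))
    exact ⟨_, hq.add hq1, by rwa [add_mul, ← sub_sub]⟩

end ConstCoeff

/-! ### Left ideals are principal -/

/-- An element of least order in a left ideal generates it, by division with remainder. Needed for
the Noetherian property, which turns one-sided inverses of matrices into two-sided ones. -/
theorem isPrincipalIdealRing (hA : IsField A) : IsPrincipalIdealRing (LODO δ) := by
  refine ⟨fun I => ?_⟩
  by_cases hI : I = ⊥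
  · exact hI ▸ ⟨0, by simp⟩
  classical
  obtain ⟨P, hPI, hP⟩ := Submodule.exists_mem_ne_zero_of_ne_bot hI
  have hex : ∃ m, ∃ d ∈ I, d.OrderLT (m + 1) ∧ d.coeff m ≠ 0 :=
    let ⟨m, h⟩ := exists_order hP
    ⟨m, P, hPI, h⟩
  obtain ⟨d, hdI, hd, hd0⟩ := Nat.find_spec hex
  obtain ⟨b, hb⟩ := hA.mul_inv_cancel hd0
  refine ⟨d, le_antisymm (fun Q hQ => ?_) ((Submodule.span_singleton_le_iff_mem _ _).2 hdI)⟩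
  -- For `ε = 0` every operator has constant coefficients, so the division applies to the whole
  -- ring.
  obtain ⟨q, -, hq⟩ := exists_sub_mul_orderLT' (ε := 0) (fun _ => by simp) (fun _ => rfl) hd hb
    (P := Q) (fun _ => rfl)
  refine Submodule.mem_span_singleton.2 ⟨q, ?_⟩
  by_contra h
  obtain ⟨n, hn, hn0⟩ := exists_order (P := Q - q * d) (fun h0 => h (sub_eq_zero.1 h0).symm)
  refine Nat.find_min hex (m := n) (not_le.1 fun hle => hn0 (hq n hle))
    ⟨_, I.sub_mem hQ (I.mul_mem_left q hdI), hn, hn0⟩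

/-! ### Simplicity -/

/-- This is `Dⁱ a = a Dⁱ + i δ(a) Dⁱ⁻¹ + ⋯`, as far as the second leading term. -/
theorem commutator_leftD_iterate (a : A) (i : ℕ) :
    (leftD^[i] (C a : LODO δ) - a • monomial i 1).OrderLT i ∧
      ∀ j, i = j + 1 →
        (leftD^[i] (C a : LODO δ) - a • monomial i 1).coeff j = i * δ a := by
  induction i with
  | zero =>
    refine ⟨orderLT_zero.2 ?_, fun j hj => by omega⟩
    rw [Function.iterate_zero, id, smul_monomial, mul_one, C, sub_self]
  | succ i ih =>
    have h : leftD^[i + 1] (C a : LODO δ) - a • monomial (i + 1) 1 =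
        leftD (leftD^[i] (C a : LODO δ) - a • monomial i 1) + δ a • monomial i 1 := by
      have h0 : (monomial i 0 : LODO δ) = 0 := Finsupp.single_zero i
      rw [Function.iterate_succ_apply', map_sub, leftD_smul, leftD_monomial,
        Derivation.map_one_eq_zero, h0, zero_add]
      abel
    rw [h]
    refine ⟨fun j hj => ?_, fun j hj => ?_⟩
    · rw [coeff_add, ih.1.leftD j hj, coeff_smul, coeff_monomial, if_neg (by omega), mul_zero,
        add_zero]
    · obtain rfl : i = j := by omega
      rw [coeff_add, coeff_smul, coeff_monomial, if_pos rfl, mul_one]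
      rcases i with _ | i
      · rw [coeff_leftD_zero, ih.1 0 le_rfl]; simp
      · rw [coeff_leftD_succ, ih.1 _ le_rfl, ih.2 i rfl]; push_cast; simp; ring

theorem commutator_eq_sum (P : LODO δ) (a : A) :
    P * C a - C a * P = ∑ i ∈ (show ℕ →₀ A from P).support,
      P.coeff i • (leftD^[i] (C a : LODO δ) - a • monomial i 1) := by
  have h : P = ∑ i ∈ (show ℕ →₀ A from P).support, P.coeff i • (monomial i 1 : LODO δ) := by
    conv_lhs => rw [← mul_one P, mul_eq_sum]
    exact Finset.sum_congr rfl fun i _ => by rw [leftD_iterate_one]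
  have h' : C a * P = ∑ i ∈ (show ℕ →₀ A from P).support,
      P.coeff i • (a • (monomial i 1 : LODO δ)) := by
    conv_lhs => rw [h, C_mul, Finset.smul_sum]
    exact Finset.sum_congr rfl fun i _ => smul_comm _ _ _
  rw [h', mul_eq_sum, ← Finset.sum_sub_distrib]
  exact Finset.sum_congr rfl fun i _ => (smul_sub _ _ _).symm

theorem OrderLT.commutator {P : LODO δ} {n : ℕ} (hP : P.OrderLT (n + 1)) (a : A) :
    (P * LODO.C a - LODO.C a * P).OrderLT n := by
  intro j hj
  rw [commutator_eq_sum, coeff_sum]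
  refine Finset.sum_eq_zero fun i _ => ?_
  rw [coeff_smul]
  rcases le_or_gt i n with h | h
  · rw [(commutator_leftD_iterate a i).1 j (h.trans hj), mul_zero]
  · rw [hP i h, zero_mul]

/-- In characteristic zero with `δ a ≠ 0`, commuting with `a` lowers a positive order by exactly
one; this drives the simplicity argument. -/
theorem OrderLT.coeff_commutator {P : LODO δ} {n : ℕ} (hP : P.OrderLT (n + 2)) (a : A) :
    (P * LODO.C a - LODO.C a * P).coeff n = P.coeff (n + 1) * ((n + 1 : ℕ) * δ a) := by
  rw [commutator_eq_sum, coeff_sum, Finset.sum_eq_single (n + 1)]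
  · rw [coeff_smul, (commutator_leftD_iterate a (n + 1)).2 n rfl]
  · intro i _ hi
    rw [coeff_smul]
    rcases le_or_gt i n with h | h
    · rw [(commutator_leftD_iterate a i).1 n h, mul_zero]
    · rw [hP i (by omega), zero_mul]
  · intro h
    rw [coeff_smul, show P.coeff (n + 1) = 0 from Finsupp.notMem_support_iff.1 h, zero_mul]

/-- The operators with constant coefficients form a simple ring: a right ideal `d R` that contains
a left ideal `R q` with `q ≠ 0` is the whole ring. -/
theorem exists_mul_eq_one_of_forall_mul_mem (hA : IsField A) [IsDomain A] [CharZero A]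
    {ε : Derivation ℤ A A} (hc : ∀ a, ε (δ a) = δ (ε a))
    {a : A} (ha : ε a = 0) (ha' : δ a ≠ 0) {d q : LODO δ} (hq : ConstCoeff ε q) (hq0 : q ≠ 0)
    (h : ∀ r, ConstCoeff ε r → ∃ s, ConstCoeff ε s ∧ r * q = d * s) :
    ∃ s, ConstCoeff ε s ∧ d * s = 1 := by
  obtain ⟨n, hn, hn0⟩ := exists_order hq0
  clear hq0
  induction n generalizing q with
  | zero =>
    -- Here `q` is multiplication by a nonzero function, so taking its inverse for `r` puts `1` into
    -- `d R`.
    obtain ⟨b, hb⟩ := hA.mul_inv_cancel hn0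
    obtain ⟨s, hs, hs'⟩ := h (C b) (ConstCoeff.C (derivation_inv_eq_zero hb (hq 0)))
    refine ⟨s, hs, ?_⟩
    rw [← hs', C_mul]
    refine ext_coeff fun i => ?_
    rw [coeff_smul, show (1 : LODO δ) = C 1 from rfl, C, coeff_monomial]
    split_ifs with hi
    · rw [← hi, mul_comm, hb]
    · rw [hn i (by omega), mul_zero]
  | succ n ih =>
    have hC : ConstCoeff ε (C a : LODO δ) := ConstCoeff.C ha
    -- Replace `q` by `q a - a q`, of order one less. The inclusion survives since `r (q a - a q) =
    -- (r q) a - (r a) q`.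
    refine ih ((hq.mul hc hC).sub (hC.mul hc hq)) (fun r hr => ?_) (hn.commutator a) ?_
    · obtain ⟨s, hs, hs'⟩ := h r hr
      obtain ⟨t, ht, ht'⟩ := h (r * C a) (hr.mul hc hC)
      refine ⟨s * C a - t, (hs.mul hc hC).sub ht, ?_⟩
      rw [mul_sub, ← mul_assoc, ← mul_assoc, mul_sub, ← mul_assoc, hs', ht']
    · rw [hn.coeff_commutator]
      exact mul_ne_zero hn0 (mul_ne_zero (Nat.cast_ne_zero.2 n.succ_ne_zero) ha')

end LODO

namespace LODO

variable {A : Type} [CommRing A] {δ : Derivation ℤ A A} {ε : Derivation ℤ A A}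

/-! ### Right linear functionals -/

/-- A functional with values in the operators with constant coefficients, linear over these
operators acting from the right. -/
structure IsFunctional (ε : Derivation ℤ A A) (f : LODO δ →+ LODO δ) : Prop where
  constCoeff (P : LODO δ) : ConstCoeff ε (f P)
  map_mul (P : LODO δ) {Q : LODO δ} (hQ : ConstCoeff ε Q) : f (P * Q) = f P * Q

theorem IsFunctional.sub {f g : LODO δ →+ LODO δ} (hf : IsFunctional ε f)
    (hg : IsFunctional ε g) : IsFunctional ε (f - g) where
  constCoeff P := (hf.constCoeff P).sub (hg.constCoeff P)
  map_mul P Q hQ := by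
    simp only [AddMonoidHom.sub_apply, hf.map_mul P hQ, hg.map_mul P hQ, sub_mul]

theorem IsFunctional.add {f g : LODO δ →+ LODO δ} (hf : IsFunctional ε f)
    (hg : IsFunctional ε g) : IsFunctional ε (f + g) where
  constCoeff P := (hf.constCoeff P).add (hg.constCoeff P)
  map_mul P Q hQ := by
    simp only [AddMonoidHom.add_apply, hf.map_mul P hQ, hg.map_mul P hQ, add_mul]

theorem IsFunctional.mulLeft (hc : ∀ a, ε (δ a) = δ (ε a)) {f : LODO δ →+ LODO δ}
    (hf : IsFunctional ε f) {r : LODO δ} (hr : ConstCoeff ε r) :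
    IsFunctional ε ((AddMonoidHom.mulLeft r).comp f) where
  constCoeff P := hr.mul hc (hf.constCoeff P)
  map_mul P Q hQ := by simp [hf.map_mul P hQ, mul_assoc]

/-- The constants of a derivation. -/
def constants (ε : Derivation ℤ A A) : Subring A where
  carrier := {a | ε a = 0}
  mul_mem' := fun {a b} (ha : ε a = 0) (hb : ε b = 0) => by
    change ε (a * b) = 0
    rw [ε.leibniz, ha, hb]; simp
  one_mem' := ε.map_one_eq_zero
  add_mem' := fun {a b} (ha : ε a = 0) (hb : ε b = 0) => by
    change ε (a + b) = 0
    rw [map_add, ha, hb, add_zero]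
  zero_mem' := map_zero ε
  neg_mem' := fun {a} (ha : ε a = 0) => by
    change ε (-a) = 0
    rw [map_neg, ha, neg_zero]

/-- A linear form on the coefficients, applied to each coefficient. -/
noncomputable def mapCoeff (δ : Derivation ℤ A A) (l : A →ₗ[constants ε] constants ε) :
    LODO δ →+ LODO δ :=
  Finsupp.mapRange.addMonoidHom ((constants ε).subtype.toAddMonoidHom.comp l.toAddMonoidHom)

theorem coeff_mapCoeff (l : A →ₗ[constants ε] constants ε) (P : LODO δ) (i : ℕ) :
    (mapCoeff δ l P).coeff i = l (P.coeff i) :=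
  Finsupp.mapRange_apply (hf := map_zero _) ..

/-- For constant `Q` the coefficients of `Dⁱ Q` are again constants, so `l` passes through them in
`a Dⁱ Q`. -/
theorem isFunctional_mapCoeff (hc : ∀ a, ε (δ a) = δ (ε a)) (l : A →ₗ[constants ε] constants ε) :
    IsFunctional ε (mapCoeff δ l) where
  constCoeff P i := by rw [coeff_mapCoeff]; exact (l (P.coeff i)).2
  map_mul P Q hQ := by
    induction P using LODO.induction with
    | h0 => simp
    | hadd P R hP hR => rw [add_mul, map_add, hP, hR, map_add, add_mul]
    | hm i a =>
      have h : mapCoeff δ l (monomial i a) = monomial i (l a : A) :=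
        Finsupp.mapRange_single (hf := by simp)
      rw [h, monomial_mul, monomial_mul]
      refine ext_coeff fun j => ?_
      have hQj := hQ.leftD_iterate hc i j
      rw [coeff_mapCoeff, coeff_smul, coeff_smul]
      have := l.map_smul (⟨_, hQj⟩ : constants ε) a
      rw [Subring.smul_def, smul_eq_mul, smul_eq_mul] at this
      rw [mul_comm, this, mul_comm]
      rfl

/-- Finitely many operators are combinations of operators with constant coefficients, the
multipliers being functions linearly independent over the constants and the operators being
given by functionals. -/
theorem exists_functional_expansion (hA : IsField A) (hc : ∀ a, ε (δ a) = δ (ε a))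
    {ι : Type*} [Fintype ι] (M : ι → LODO δ) :
    ∃ (κ : Type) (_ : Fintype κ) (e : κ → A) (f : κ → LODO δ →+ LODO δ),
      LinearIndependent (constants ε) e ∧ (∀ s, IsFunctional ε (f s)) ∧
      ∀ j, M j = ∑ s, C (e s) * f s (M j) := by
  classical
  have hK : IsField (constants ε) :=
    { exists_pair_ne := ⟨0, 1, fun h => by
        obtain ⟨a, b, hab⟩ := hA.exists_pair_ne
        have h1 : (0 : A) = 1 := congrArg Subtype.val h
        exact hab (by rw [← one_mul a, ← one_mul b, ← h1, zero_mul, zero_mul])⟩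
      mul_comm := mul_comm
      mul_inv_cancel := fun {a} ha => by
        obtain ⟨b, hb⟩ := hA.mul_inv_cancel (a := (a : A)) (fun h => ha (Subtype.ext h))
        exact ⟨⟨b, derivation_inv_eq_zero hb a.2⟩, Subtype.ext hb⟩ }
  have hfree : Module.Free (constants ε) A := by
    let := hK.toField
    infer_instance
  let b := Module.Free.chooseBasis (constants ε) A
  -- The finitely many basis elements that occur in some coefficient of some `M j`.
  let t : Finset (Module.Free.ChooseBasisIndex (constants ε) A) :=
    Finset.univ.biUnion fun j => (show ℕ →₀ A from M j).support.biUnion fun i =>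
      (b.repr ((M j).coeff i)).support
  refine ⟨t, inferInstance, fun s => b s, fun s => mapCoeff δ (b.coord s),
    b.linearIndependent.comp _ Subtype.val_injective,
    fun s => isFunctional_mapCoeff hc _, fun j => ext_coeff fun i => ?_⟩
  simp only [coeff_sum, C_mul, coeff_smul, coeff_mapCoeff]
  rw [Finset.sum_coe_sort t (fun s => b s * (b.coord s ((M j).coeff i) : A))]
  conv_lhs => rw [← b.linearCombination_repr ((M j).coeff i), Finsupp.linearCombination_apply]
  rw [Finsupp.sum_of_support_subset (s := t)]
  · exact Finset.sum_congr rfl fun s _ => by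
      rw [Subring.smul_def, smul_eq_mul, mul_comm]; rfl
  · intro s hs
    refine Finset.mem_biUnion.2 ⟨j, Finset.mem_univ _, Finset.mem_biUnion.2 ⟨i, ?_, hs⟩⟩
    refine Finsupp.mem_support_iff.2 fun h => ?_
    rw [show (M j).coeff i = 0 from h] at hs
    simp at hs
  · simp

theorem exists_functional_ne_zero (hA : IsField A) (hc : ∀ a, ε (δ a) = δ (ε a)) {P : LODO δ}
    (hP : P ≠ 0) : ∃ f : LODO δ →+ LODO δ, IsFunctional ε f ∧ f P ≠ 0 := by
  obtain ⟨κ, _, e, f, -, hf, h⟩ := exists_functional_expansion hA hc (fun _ : Unit => P)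
  by_contra! h0
  refine hP ((h ()).trans (Finset.sum_eq_zero fun s _ => ?_))
  rw [h0 _ (hf s), mul_zero]

/-! ### Action on a differential module -/

section Action

variable {S : Type*} [AddCommGroup S] [Module A S]

/-- The action of an operator on a module with an operator `DX` in place of `D`. -/
noncomputable def act (DX : S →+ S) (P : LODO δ) (s : S) : S :=
  Finsupp.sum (show ℕ →₀ A from P) fun i a => a • DX^[i] s

variable {DX DY : S →+ S}

theorem act_add (P Q : LODO δ) (s : S) : act DX (P + Q) s = act DX P s + act DX Q s :=
  Finsupp.sum_add_index' (fun _ => zero_smul A _) (fun _ _ _ => add_smul _ _ _)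

theorem act_zero (s : S) : act DX (0 : LODO δ) s = 0 := Finsupp.sum_zero_index

theorem act_sum {ι : Type*} (t : Finset ι) (P : ι → LODO δ) (s : S) :
    act DX (∑ i ∈ t, P i) s = ∑ i ∈ t, act DX (P i) s :=
  map_sum (AddMonoidHom.mk' (fun P : LODO δ => act DX P s) fun P Q => act_add P Q s) P t

theorem act_monomial (i : ℕ) (a : A) (s : S) : act DX (monomial i a : LODO δ) s = a • DX^[i] s :=
  Finsupp.sum_single_index (zero_smul A _)

theorem act_one (s : S) : act DX (1 : LODO δ) s = s :=
  (act_monomial 0 1 s).trans (one_smul A s)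

theorem act_map_sum {ι : Type*} (t : Finset ι) (P : LODO δ) (s : ι → S) :
    act DX P (∑ i ∈ t, s i) = ∑ i ∈ t, act DX P (s i) := by
  induction P using LODO.induction with
  | h0 => simp [act_zero]
  | hadd P Q hP hQ => simp only [act_add, hP, hQ, Finset.sum_add_distrib]
  | hm i a =>
    simp only [act_monomial, ← Finset.smul_sum]
    congr 1
    exact map_sum ((show AddMonoid.End S from DX) ^ i) s t

theorem act_map_zero (P : LODO δ) : act DX P (0 : S) = 0 := by
  simpa using act_map_sum (DX := DX) ∅ P (fun _ : Unit => (0 : S))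

theorem act_smul (a : A) (P : LODO δ) (s : S) : act DX (a • P) s = a • act DX P s := by
  induction P using LODO.induction with
  | h0 => simp [act_zero]
  | hadd P Q hP hQ => rw [smul_add, act_add, hP, hQ, act_add, smul_add]
  | hm i b => rw [smul_monomial, act_monomial, act_monomial, mul_smul]

theorem act_leftD (hDX : ∀ (a : A) s, DX (a • s) = δ a • s + a • DX s) (P : LODO δ) (s : S) :
    act DX (leftD P) s = DX (act DX P s) := by
  induction P using LODO.induction with
  | h0 => simp [act_zero]
  | hadd P Q hP hQ => rw [map_add, act_add, hP, hQ, act_add, map_add]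
  | hm i b =>
    rw [leftD_monomial, act_add, act_monomial, act_monomial, act_monomial, hDX,
      Function.iterate_succ_apply']

theorem act_mul (hDX : ∀ (a : A) s, DX (a • s) = δ a • s + a • DX s) (P Q : LODO δ) (s : S) :
    act DX (P * Q) s = act DX P (act DX Q s) := by
  induction P using LODO.induction with
  | h0 => simp [act_zero]
  | hadd P R hP hR => rw [add_mul, act_add, hP, hR, act_add]
  | hm i b =>
    rw [monomial_mul, act_smul, act_monomial]
    congr 1
    induction i with
    | zero => rfl
    | succ i ih =>
      rw [Function.iterate_succ_apply', act_leftD hDX, ih, Function.iterate_succ_apply']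

theorem derivation_act_eq_zero (hDY : ∀ (a : A) s, DY (a • s) = ε a • s + a • DY s)
    (hcomm : ∀ s, DY (DX s) = DX (DY s)) {P : LODO δ} (hP : ConstCoeff ε P) {s : S}
    (hs : DY s = 0) : DY (act DX P s) = 0 := by
  have h : ∀ i, DY (DX^[i] s) = 0 := fun i => by
    induction i with
    | zero => exact hs
    | succ i ih => rw [Function.iterate_succ_apply', hcomm, ih, map_zero]
  unfold act Finsupp.sum
  rw [map_sum]
  refine Finset.sum_eq_zero fun i _ => ?_
  rw [hDY, h, show ε ((show ℕ →₀ A from P) i) = 0 from hP i, zero_smul, smul_zero, add_zero]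

/-- Functions linearly independent over the constants of `ε` stay so over the `DY`-constants of a
differential module. -/
theorem eq_zero_of_sum_smul_eq_zero (hA : IsField A)
    (hDY : ∀ (a : A) s, DY (a • s) = ε a • s + a • DY s) {κ : Type*} (t : Finset κ) (e : κ → A)
    (he : ∀ c : κ → A, (∀ i ∈ t, ε (c i) = 0) → ∑ i ∈ t, c i * e i = 0 → ∀ i ∈ t, c i = 0)
    (s : κ → S) (hs : ∀ i ∈ t, DY (s i) = 0) (h : ∑ i ∈ t, e i • s i = 0) :
    ∀ i ∈ t, s i = 0 := by
  classical
  induction t using Finset.induction_on generalizing e with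
  | empty => simp
  | insert k t hk ih =>
    -- Otherwise the indicator of `k` would be a nontrivial relation.
    have hek : e k ≠ 0 := fun h0 => by
      have h1 := he (Pi.single k 1) (fun i _ => by
        rcases eq_or_ne i k with rfl | hi
        · rw [Pi.single_eq_same, ε.map_one_eq_zero]
        · rw [Pi.single_eq_of_ne hi, map_zero]) (by
        refine Finset.sum_eq_zero fun i _ => ?_
        rcases eq_or_ne i k with rfl | hi
        · rw [h0, mul_zero]
        · rw [Pi.single_eq_of_ne hi, zero_mul]) k (Finset.mem_insert_self _ _)
      obtain ⟨a, b, hab⟩ := hA.exists_pair_ne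
      rw [Pi.single_eq_same] at h1
      exact hab (by rw [← one_mul a, ← one_mul b, h1, zero_mul, zero_mul])
    obtain ⟨b, hb⟩ := hA.mul_inv_cancel hek
    have hsum : s k + ∑ i ∈ t, (b * e i) • s i = 0 := by
      rw [Finset.sum_insert hk] at h
      have := congrArg (b • ·) h
      simp only [smul_add, Finset.smul_sum, smul_smul, smul_zero] at this
      rwa [mul_comm b (e k), hb, one_smul] at this
    -- Wronskian-style elimination: after division by `e k`, applying `DY` removes the constant `s
    -- k` and leaves a shorter relation with multipliers `ε (b * e i)`.
    have hzero : ∀ i ∈ t, s i = 0 := by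
      refine ih (fun i => ε (b * e i)) (fun c hc h0 => ?_)
        (fun i hi => hs i (Finset.mem_insert_of_mem hi)) ?_
      -- The new multipliers are independent: if `∑ c i ε(b e i) = 0`, then `∑ c i b e i` is a
      -- constant, and its negative serves as the coefficient of `e k` in a relation among the old
      -- ones.
      · have hconst : ε (∑ i ∈ t, c i * (b * e i)) = 0 := by
          rw [map_sum, ← h0]
          refine Finset.sum_congr rfl fun i hi => ?_
          rw [ε.leibniz, hc i hi, smul_zero, add_zero, smul_eq_mul]
        have h1 := he (fun i => if i = k then -∑ i ∈ t, c i * (b * e i) else c i)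
          (fun i hi => by
            split_ifs with hik
            · rw [map_neg, hconst, neg_zero]
            · exact hc i (Finset.mem_of_mem_insert_of_ne hi hik)) (by
            rw [Finset.sum_insert hk, if_pos rfl, neg_mul, Finset.sum_mul, neg_add_eq_zero]
            refine Finset.sum_congr rfl fun i hi => ?_
            rw [if_neg (ne_of_mem_of_not_mem hi hk)]
            calc c i * (b * e i) * e k = c i * e i * (e k * b) := by ring
              _ = c i * e i := by rw [hb, mul_one])
        intro i hi
        have := h1 i (Finset.mem_insert_of_mem hi)
        rwa [if_neg (ne_of_mem_of_not_mem hi hk)] at this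
      · have h1 := congrArg DY hsum
        rw [map_add, hs k (Finset.mem_insert_self _ _), zero_add, map_sum, map_zero] at h1
        rw [← h1]
        refine Finset.sum_congr rfl fun i hi => ?_
        rw [hDY, hs i (Finset.mem_insert_of_mem hi), smul_zero, add_zero]
    intro i hi
    rcases Finset.mem_insert.1 hi with rfl | hi
    · rw [← hsum, Finset.sum_eq_zero fun j hj => by rw [hzero j hj, smul_zero], add_zero]
    · exact hzero i hi

/-- A row of operators possessing a dual system of functionals annihilates no `DY`-constants. -/
theorem eq_zero_of_sum_act_eq_zero (hA : IsField A) (hc : ∀ a, ε (δ a) = δ (ε a))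
    (hDX : ∀ (a : A) s, DX (a • s) = δ a • s + a • DX s)
    (hDY : ∀ (a : A) s, DY (a • s) = ε a • s + a • DY s)
    (hcomm : ∀ s, DY (DX s) = DX (DY s))
    {ι : Type*} [Fintype ι] [DecidableEq ι] (M : ι → LODO δ) (f : ι → LODO δ →+ LODO δ)
    (hf : ∀ i, IsFunctional ε (f i)) (hfM : ∀ i j, f i (M j) = if i = j then 1 else 0)
    (s : ι → S) (hs : ∀ i, DY (s i) = 0) (h : ∑ i, act DX (M i) (s i) = 0) (i : ι) :
    s i = 0 := by
  obtain ⟨κ, _, e, g, he, hg, hM⟩ := exists_functional_expansion hA hc M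
  have h1 : ∑ k, e k • ∑ j, act DX (g k (M j)) (s j) = 0 := by
    rw [← h]
    simp only [Finset.smul_sum]
    rw [Finset.sum_comm]
    refine Finset.sum_congr rfl fun j _ => ?_
    conv_rhs => rw [hM j, act_sum]
    exact Finset.sum_congr rfl fun k _ => by rw [C_mul, act_smul]
  -- Each inner sum is a `DY`-constant, so independence of the `e k` separates the relation.
  have h2 := eq_zero_of_sum_smul_eq_zero hA hDY Finset.univ e (fun c hc' h0 k _ => by
      have := Fintype.linearIndependent_iff.1 he (fun k => ⟨c k, hc' k (Finset.mem_univ k)⟩)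
        (by simpa [Subring.smul_def] using h0) k
      exact congrArg Subtype.val this) _ (fun k _ => by
      rw [map_sum]
      exact Finset.sum_eq_zero fun j _ =>
        derivation_act_eq_zero hDY hcomm ((hg k).constCoeff _) (hs j)) h1
  -- Right linearity expresses the dual system through the expansion, so the vanishing inner sums
  -- recombine to `s i`.
  have h3 : ∀ j, f i (M j) = ∑ k, f i (C (e k)) * g k (M j) := fun j => by
    conv_lhs => rw [hM j, map_sum]
    exact Finset.sum_congr rfl fun k _ => (hf i).map_mul _ ((hg k).constCoeff _)
  calc s i = ∑ j, act DX (f i (M j)) (s j) := by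
        rw [Finset.sum_eq_single i]
        · rw [hfM, if_pos rfl, act_one]
        · intro j _ hj
          rw [hfM, if_neg hj.symm, act_zero]
        · simp
    _ = ∑ k, act DX (f i (C (e k))) (∑ j, act DX (g k (M j)) (s j)) := by
        simp only [h3, act_sum, act_mul hDX, act_map_sum]
        exact Finset.sum_comm
    _ = 0 := Finset.sum_eq_zero fun k hk => by rw [h2 k hk, act_map_zero]

end Action

/-! ### Matrices with a one-sided inverse -/

/-- Multiplying row vectors by `R` is surjective, since `X` supplies preimages. The rank condition
then gives `k ≤ p`, so the matrices are square, and over a left Noetherian ring a one-sided inverse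
is two-sided. -/
theorem mul_eq_one_symm_of_le [IsDomain A] (hA : IsField A) {p k : ℕ} (hpk : p ≤ k)
    {X : Matrix (Fin k) (Fin p) (LODO δ)} {R : Matrix (Fin p) (Fin k) (LODO δ)}
    (h : X * R = 1) : R * X = 1 := by
  have := isPrincipalIdealRing (δ := δ) hA
  have hk : k ≤ p := le_of_fin_surjective (LODO δ) (Matrix.toLinearMapRight' R) fun v =>
    ⟨v ᵥ* X, by rw [Matrix.toLinearMapRight'_apply, Matrix.vecMul_vecMul, h, Matrix.vecMul_one]⟩
  obtain rfl := le_antisymm hpk hk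
  exact mul_eq_one_symm h

end LODO

/-! ### Smooth generic functions -/

namespace GenericFunction

variable {𝕜 : Type} [RCLike 𝕜] {Ω : TopologicalSpace.Opens (ℝ × ℝ)}

theorem genericFilter_neBot (hΩ : (Ω : Set (ℝ × ℝ)).Nonempty) : (genericFilter Ω).NeBot := by
  refine ⟨fun h => ?_⟩
  obtain ⟨V, hV, hV'⟩ := mem_genericFilter.1 (h ▸ Filter.mem_bot : ∅ ∈ genericFilter Ω)
  obtain ⟨z, hz⟩ := hΩ
  have := hV.2.2 hz
  rw [Set.subset_empty_iff.1 hV', closure_empty] at this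
  exact this

theorem IsSmooth.zero : (0 : GenericFunction 𝕜 Ω).IsSmooth :=
  ⟨0, Ω, ⟨Ω.isOpen, subset_rfl, subset_closure⟩, contDiffOn_const, rfl⟩

theorem IsSmooth.add {f g : GenericFunction 𝕜 Ω} (hf : f.IsSmooth) (hg : g.IsSmooth) :
    (f + g).IsSmooth := by
  obtain ⟨u, V, hV, hu, rfl⟩ := hf
  obtain ⟨v, W, hW, hv, rfl⟩ := hg
  exact ⟨u + v, V ∩ W, hV.inter hW,
    (hu.mono Set.inter_subset_left).add (hv.mono Set.inter_subset_right), rfl⟩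

theorem IsSmooth.mul {f g : GenericFunction 𝕜 Ω} (hf : f.IsSmooth) (hg : g.IsSmooth) :
    (f * g).IsSmooth := by
  obtain ⟨u, V, hV, hu, rfl⟩ := hf
  obtain ⟨v, W, hW, hv, rfl⟩ := hg
  exact ⟨u * v, V ∩ W, hV.inter hW,
    (hu.mono Set.inter_subset_left).mul (hv.mono Set.inter_subset_right), rfl⟩

theorem dirDeriv_coe_eq_fderiv (w : ℝ × ℝ) {u : ℝ × ℝ → 𝕜} {V : Set (ℝ × ℝ)}
    (hV : IsDenseOpenIn Ω V) (hu : ContDiffOn ℝ ∞ u V) :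
    dirDeriv w (u : GenericFunction 𝕜 Ω) =
      ((fun z => fderiv ℝ u z w : ℝ × ℝ → 𝕜) : GenericFunction 𝕜 Ω) :=
  Filter.Germ.coe_eq.2 (mem_genericFilter.2 ⟨V, hV, fun _ hz =>
    ((hu.contDiffAt (hV.1.mem_nhds hz)).differentiableAt (by simp)).lineDeriv_eq_fderiv⟩)

theorem contDiffOn_fderiv_apply (w : ℝ × ℝ) {u : ℝ × ℝ → 𝕜} {V : Set (ℝ × ℝ)}
    (hV : IsOpen V) (hu : ContDiffOn ℝ ∞ u V) :
    ContDiffOn ℝ ∞ (fun z => fderiv ℝ u z w) V :=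
  (hu.fderiv_of_isOpen hV (by simp)).clm_apply contDiffOn_const

theorem IsSmooth.dirDeriv (w : ℝ × ℝ) {f : GenericFunction 𝕜 Ω} (hf : f.IsSmooth) :
    (dirDeriv w f).IsSmooth := by
  obtain ⟨u, V, hV, hu, rfl⟩ := hf
  exact ⟨_, V, hV, contDiffOn_fderiv_apply w hV.1 hu, (dirDeriv_coe_eq_fderiv w hV hu).symm⟩

theorem dirDeriv_comm (v w : ℝ × ℝ) {f : GenericFunction 𝕜 Ω} (hf : f.IsSmooth) :
    GenericFunction.dirDeriv v (GenericFunction.dirDeriv w f) =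
      GenericFunction.dirDeriv w (GenericFunction.dirDeriv v f) := by
  obtain ⟨u, V, hV, hu, rfl⟩ := hf
  rw [dirDeriv_coe_eq_fderiv w hV hu, dirDeriv_coe_eq_fderiv v hV hu,
    dirDeriv_coe_eq_fderiv v hV (contDiffOn_fderiv_apply w hV.1 hu),
    dirDeriv_coe_eq_fderiv w hV (contDiffOn_fderiv_apply v hV.1 hu)]
  refine Filter.Germ.coe_eq.2 (mem_genericFilter.2 ⟨V, hV, fun z hz => ?_⟩)
  have hz' := hu.contDiffAt (hV.1.mem_nhds hz)
  have hd : DifferentiableAt ℝ (fderiv ℝ u) z :=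
    (hz'.fderiv_right (m := 1) (by norm_cast)).differentiableAt (by simp)
  have hs : IsSymmSndFDerivAt ℝ u z := hz'.isSymmSndFDerivAt (by
    rw [minSmoothness_of_isRCLikeNormedField]; norm_cast)
  change fderiv ℝ (fun z => fderiv ℝ u z w) z v = fderiv ℝ (fun z => fderiv ℝ u z v) z w
  rw [fderiv_clm_apply hd (differentiableAt_const _), fderiv_clm_apply hd (differentiableAt_const _)]
  simpa using hs.eq v w

/-- A function of `x`, as a function in the plane. -/
noncomputable def ofX (Ω : TopologicalSpace.Opens (ℝ × ℝ)) (φ : ℝ → 𝕜) : GenericFunction 𝕜 Ω :=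
  ((fun z : ℝ × ℝ => φ z.1 : ℝ × ℝ → 𝕜) : GenericFunction 𝕜 Ω)

theorem partialX_ofX (φ : ℝ → 𝕜) : (ofX Ω φ).partialX = ofX Ω (deriv φ) := by
  refine congrArg (fun v : ℝ × ℝ → 𝕜 => (v : GenericFunction 𝕜 Ω)) (funext fun z => ?_)
  simp only [lineDeriv, Prod.smul_mk, Prod.fst_add, smul_eq_mul, mul_one]
  rw [deriv_comp_const_add, add_zero]

theorem partialY_ofX (φ : ℝ → 𝕜) : (ofX Ω φ).partialY = 0 := by
  refine congrArg (fun v : ℝ × ℝ → 𝕜 => (v : GenericFunction 𝕜 Ω)) (funext fun z => ?_)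
  simp [lineDeriv]

theorem isSmooth_ofX {φ : ℝ → 𝕜} (hφ : ContDiffOn ℝ ∞ φ (Prod.fst '' (Ω : Set (ℝ × ℝ)))) :
    (ofX Ω φ).IsSmooth :=
  ⟨_, Ω, ⟨Ω.isOpen, subset_rfl, subset_closure⟩,
    hφ.comp contDiffOn_fst (Set.mapsTo_image _ _), rfl⟩

/-- If `φ` is nonzero at a point, it is nonzero on an open part of `Ω` by continuity, and this meets
every dense open subset. -/
theorem eq_zero_of_ofX_eq_zero {φ : ℝ → 𝕜}
    (hφ : ContinuousOn φ (Prod.fst '' (Ω : Set (ℝ × ℝ)))) (h : ofX Ω φ = 0) :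
    ∀ x ∈ Prod.fst '' (Ω : Set (ℝ × ℝ)), φ x = 0 := by
  rintro _ ⟨z, hz, rfl⟩
  by_contra hne
  obtain ⟨V, hV, hVS⟩ := mem_genericFilter.1 (Filter.Germ.coe_eq.1 h)
  have hc : ContinuousOn (fun z : ℝ × ℝ => φ z.1) Ω :=
    hφ.comp continuous_fst.continuousOn (Set.mapsTo_image _ _)
  obtain ⟨v, hv, hvV⟩ := mem_closure_iff.1 (hV.2.2 hz) _
    (hc.isOpen_inter_preimage Ω.isOpen isOpen_compl_singleton) ⟨hz, hne⟩
  exact hv.2 (hVS hvV)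

end GenericFunction

/-! ### The field `F`, its action on smooth functions, and dual systems as a criterion for
irreducibility -/

namespace PlaneFunctionField

variable {𝕜 : Type} [RCLike 𝕜] {Ω : TopologicalSpace.Opens (ℝ × ℝ)} (F : PlaneFunctionField 𝕜 Ω)

theorem isField (hΩ : (Ω : Set (ℝ × ℝ)).Nonempty) : IsField F.Elem where
  exists_pair_ne := by
    have := GenericFunction.genericFilter_neBot hΩ
    exact ⟨0, 1, fun h => zero_ne_one (α := GenericFunction 𝕜 Ω) (congrArg Subtype.val h)⟩
  mul_comm := mul_comm
  mul_inv_cancel {a} ha := by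
    obtain ⟨b, hb, hab⟩ := F.inv_mem' a a.2 fun h => ha (Subtype.ext h)
    exact ⟨⟨b, hb⟩, Subtype.ext hab⟩

theorem charZero (hΩ : (Ω : Set (ℝ × ℝ)).Nonempty) : CharZero F.Elem := by
  have := GenericFunction.genericFilter_neBot hΩ
  refine ⟨fun m n h => ?_⟩
  have h' : ((m : 𝕜) : GenericFunction 𝕜 Ω) = ((n : 𝕜) : GenericFunction 𝕜 Ω) :=
    congrArg Subtype.val h
  exact Nat.cast_injective (Filter.Germ.const_inj.1 h')

theorem dy_dx (a : F.Elem) : F.dy (F.dx a) = F.dx (F.dy a) :=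
  Subtype.ext (GenericFunction.dirDeriv_comm _ _ (F.smooth' _ a.2))

/-- All smooth generic functions. -/
def smoothSubmodule : Submodule F.Elem (GenericFunction 𝕜 Ω) where
  carrier := {f | f.IsSmooth}
  add_mem' := GenericFunction.IsSmooth.add
  zero_mem' := GenericFunction.IsSmooth.zero
  smul_mem' a _ hf := (F.smooth' _ a.2).mul hf

/-- A directional derivative of smooth generic functions. -/
noncomputable def smoothDeriv (w : ℝ × ℝ) : F.smoothSubmodule →+ F.smoothSubmodule :=
  AddMonoidHom.mk' (fun f => ⟨GenericFunction.dirDeriv w f.1, f.2.dirDeriv w⟩)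
    fun f g => Subtype.ext (GenericFunction.dirDeriv_add w f.2 g.2)

variable {F}

theorem smoothDeriv_X_smul (a : F.Elem) (s : F.smoothSubmodule) :
    F.smoothDeriv (1, 0) (a • s) = F.dx a • s + a • F.smoothDeriv (1, 0) s := by
  refine Subtype.ext ((GenericFunction.dirDeriv_mul _ (F.smooth' _ a.2) s.2).trans ?_)
  rw [add_comm, mul_comm s.1]
  rfl

theorem smoothDeriv_Y_smul (a : F.Elem) (s : F.smoothSubmodule) :
    F.smoothDeriv (0, 1) (a • s) = F.dy a • s + a • F.smoothDeriv (0, 1) s := by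
  refine Subtype.ext ((GenericFunction.dirDeriv_mul _ (F.smooth' _ a.2) s.2).trans ?_)
  rw [add_comm, mul_comm s.1]
  rfl

theorem coe_act_ofX (L : F.Op) {φ : ℝ → 𝕜} (h : (GenericFunction.ofX Ω φ).IsSmooth) :
    ((LODO.act (F.smoothDeriv (1, 0)) L ⟨GenericFunction.ofX Ω φ, h⟩ : F.smoothSubmodule) :
      GenericFunction 𝕜 Ω) = apply L φ := by
  have hi : ∀ i, (((F.smoothDeriv (1, 0))^[i] ⟨GenericFunction.ofX Ω φ, h⟩ :
      F.smoothSubmodule) : GenericFunction 𝕜 Ω) = GenericFunction.ofX Ω (iteratedDeriv i φ) := by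
    intro i
    induction i with
    | zero => rw [iteratedDeriv_zero]; rfl
    | succ i ih =>
      rw [Function.iterate_succ_apply', iteratedDeriv_succ, ← GenericFunction.partialX_ofX, ← ih]
      rfl
  unfold LODO.act apply Finsupp.sum
  rw [Submodule.coe_sum]
  refine Finset.sum_congr rfl fun i _ => ?_
  rw [Submodule.coe_smul, hi]
  rfl

/-- A dual system of functionals for a row of operators. -/
def HasDualSystem {k : ℕ} (M : Fin k → F.Op) : Prop :=
  ∃ f : Fin k → F.Op →+ F.Op, (∀ i, LODO.IsFunctional F.dy (f i)) ∧
    ∀ i j, f i (M j) = if i = j then 1 else 0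

theorem HasDualSystem.kernelIrreducible (hΩ : (Ω : Set (ℝ × ℝ)).Nonempty) {k : ℕ}
    {M : Fin k → F.Op} (hM : HasDualSystem M) : KernelIrreducible M := by
  obtain ⟨f, hf, hfM⟩ := hM
  intro φ hφ h j
  refine GenericFunction.eq_zero_of_ofX_eq_zero (hφ j).continuousOn (congrArg Subtype.val
    (LODO.eq_zero_of_sum_act_eq_zero (F.isField hΩ) F.dy_dx smoothDeriv_X_smul smoothDeriv_Y_smul
      (fun s => Subtype.ext (GenericFunction.dirDeriv_comm _ _ s.2)) M f hf hfM
      (fun j => ⟨_, GenericFunction.isSmooth_ofX (hφ j)⟩)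
      (fun j => Subtype.ext (GenericFunction.partialY_ofX (φ j))) (Subtype.ext ?_) j))
  rw [Submodule.coe_sum, Submodule.coe_zero, ← h]
  exact Finset.sum_congr rfl fun j _ => coe_act_ofX _ _

/-- Applying the functionals to `M = N R` yields the explicit left inverse `f i (N r)` of `R`, which
`p ≤ k` makes two-sided. -/
theorem HasDualSystem.not_operatorReducible (hΩ : (Ω : Set (ℝ × ℝ)).Nonempty) {k : ℕ}
    {M : Fin k → F.Op} (hM : HasDualSystem M) : ¬ OperatorReducible M := by
  obtain ⟨f, hf, hfM⟩ := hM
  rintro ⟨p, hp, N, R, hR, hR', rfl⟩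
  have := (F.isField hΩ).isDomain
  have h : (Matrix.of fun i r => f i (N r)) * R = 1 := by
    ext1 i j
    rw [Matrix.one_apply, ← hfM i j, Matrix.mul_apply, Matrix.vecMul, dotProduct, map_sum]
    exact Finset.sum_congr rfl fun r _ => ((hf i).map_mul _ (hR r j)).symm
  exact hR' ⟨_, fun i r => (hf i).constCoeff _,
    LODO.mul_eq_one_symm_of_le (F.isField hΩ) hp h, h⟩

end PlaneFunctionField

/-! ### Reduction of a row by admissible operations -/

namespace PlaneFunctionField

variable {𝕜 : Type} [RCLike 𝕜] {Ω : TopologicalSpace.Opens (ℝ × ℝ)} {F : PlaneFunctionField 𝕜 Ω}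

theorem AdmissibleStep.vecCons {k : ℕ} (v : F.Op) {T T' : Fin k → F.Op}
    (h : AdmissibleStep T T') :
    AdmissibleStep (Matrix.vecCons v T) (Matrix.vecCons v T') := by
  cases h with
  | swap i j =>
    convert AdmissibleStep.swap (Matrix.vecCons v T) i.succ j.succ using 1
    funext l
    refine Fin.cases ?_ (fun l => ?_) l
    · rw [Function.comp_apply, Equiv.swap_apply_of_ne_of_ne (Fin.succ_ne_zero i).symm
        (Fin.succ_ne_zero j).symm]
      rfl
    · rw [Function.comp_apply, ← (Fin.succ_injective k).map_swap]
      rfl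
  | scale i g hg hx =>
    convert AdmissibleStep.scale (Matrix.vecCons v T) i.succ g hg hx using 1
    exact Fin.cons_update _ _ _ _
  | add i j hij A hA =>
    convert AdmissibleStep.add (Matrix.vecCons v T) i.succ j.succ
      (fun h => hij (Fin.succ_injective k h)) A hA using 1
    exact Fin.cons_update _ _ _ _

theorem reflTransGen_vecCons {k : ℕ} (v : F.Op) {T T' : Fin k → F.Op}
    (h : Relation.ReflTransGen AdmissibleStep T T') :
    Relation.ReflTransGen AdmissibleStep (Matrix.vecCons v T) (Matrix.vecCons v T') :=
  h.lift (Matrix.vecCons v) fun _ _ => AdmissibleStep.vecCons v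

/-- Multiples of the first component can be added to the other ones. -/
theorem reflTransGen_add_mul {k : ℕ} (v : F.Op) (T q : Fin k → F.Op) (hq : ∀ j, XOnly (q j)) :
    Relation.ReflTransGen AdmissibleStep (Matrix.vecCons v T)
      (Matrix.vecCons v fun j => T j + v * q j) := by
  classical
  suffices h : ∀ s : Finset (Fin k), Relation.ReflTransGen AdmissibleStep (Matrix.vecCons v T)
      (Matrix.vecCons v fun j => if j ∈ s then T j + v * q j else T j) by
    simpa using h Finset.univ
  intro s
  induction s using Finset.induction_on with
  | empty => simpa using Relation.ReflTransGen.refl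
  | insert i s hi ih =>
    refine ih.tail ?_
    convert AdmissibleStep.add _ i.succ 0 (Fin.succ_ne_zero i) (q i) (hq i) using 1
    refine Eq.trans ?_ (Fin.cons_update _ _ _ _)
    refine congrArg (Matrix.vecCons v) (funext fun j => ?_)
    rcases eq_or_ne j i with rfl | hj
    · rw [Function.update_self]
      simp [hi]
    · rw [Function.update_of_ne hj]
      simp [hj]

/-- The operations stay within the right span of the components. Thus a functional that kills the
tail still kills it after the recursive reduction. -/
theorem functional_eq_zero_of_reflTransGen {k : ℕ} {L L' : Fin k → F.Op} {f : F.Op →+ F.Op}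
    (hf : LODO.IsFunctional F.dy f) (h : Relation.ReflTransGen AdmissibleStep L L')
    (hL : ∀ i, f (L i) = 0) : ∀ i, f (L' i) = 0 := by
  induction h with
  | refl => exact hL
  | tail _ hstep ih =>
    cases hstep with
    | swap i j => exact fun l => ih _
    | scale i g hg hx =>
      intro l
      rcases eq_or_ne l i with rfl | hl
      · rw [Function.update_self, hf.map_mul _ (LODO.ConstCoeff.C hx), ih, zero_mul]
      · rw [Function.update_of_ne hl, ih]
    | add i j hij A hA =>
      intro l
      rcases eq_or_ne l i with rfl | hl
      · rw [Function.update_self, map_add, hf.map_mul _ hA, ih, ih, zero_mul, add_zero]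
      · rw [Function.update_of_ne hl, ih]

theorem dropZeros_single {k : ℕ} (v : F.Op) {M : Fin 1 → F.Op} {R : F.Op}
    (h : M (Fin.last 0) * R = v) :
    DropZeros (Matrix.vecCons v (0 : Fin k → F.Op))
      (Fin.snoc (α := fun _ => F.Op) (fun i : Fin 0 => M i.castSucc) (M (Fin.last 0) * R)) := by
  refine ⟨Fin.castLEOrderEmb (by omega), fun i => ?_, fun j => ?_⟩
  · obtain rfl : i = Fin.last 0 := Fin.fin_one_eq_zero i
    rw [Fin.snoc_last, h]
    rfl
  · refine Fin.cases (fun h0 => absurd ⟨0, rfl⟩ h0) (fun j _ => rfl) j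

theorem DropZeros.vecCons {k n : ℕ} (v : F.Op) {T : Fin k → F.Op} {M : Fin (n + 1) → F.Op}
    {R : F.Op} (h : DropZeros T (Fin.snoc (α := fun _ => F.Op) (fun i : Fin n => M i.castSucc)
      (M (Fin.last n) * R))) :
    DropZeros (Matrix.vecCons v T) (Fin.snoc (α := fun _ => F.Op)
      (fun i : Fin (n + 1) => Matrix.vecCons v M i.castSucc)
      (Matrix.vecCons v M (Fin.last (n + 1)) * R)) := by
  obtain ⟨e, he, he'⟩ := h
  have hmono : StrictMono (Matrix.vecCons 0 (fun i => (e i).succ) : Fin (n + 2) → Fin (k + 1)) := by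
    refine Fin.strictMono_iff_lt_succ.2 fun i => Fin.cases ?_ (fun i => ?_) i
    · exact Fin.succ_pos _
    · exact Fin.succ_lt_succ_iff.2 (e.strictMono i.castSucc_lt_succ)
  refine ⟨OrderEmbedding.ofStrictMono _ hmono, fun i => ?_, fun j => ?_⟩
  · refine Fin.lastCases ?_ (fun i => ?_) i
    · rw [Fin.snoc_last]
      have := he (Fin.last n)
      rw [Fin.snoc_last] at this
      exact this
    · rw [Fin.snoc_castSucc]
      refine Fin.cases rfl (fun i => ?_) i
      have := he i.castSucc
      rw [Fin.snoc_castSucc] at this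
      exact this
  · refine Fin.cases (fun h0 => absurd ⟨0, rfl⟩ h0) (fun j h0 => he' j ?_) j
    rintro ⟨i, rfl⟩
    exact h0 ⟨i.succ, rfl⟩

/-- Correct each `g i` to `g i - g i (v) f`: it now kills `v`, and its values on `M` are unchanged
because `f` vanishes there. -/
theorem HasDualSystem.vecCons [IsDomain F.Elem] {n : ℕ} {v : F.Op} {f : F.Op →+ F.Op}
    (hf : LODO.IsFunctional F.dy f) (hv : f v = 1) {M : Fin n → F.Op} (hfM : ∀ j, f (M j) = 0)
    (hM : HasDualSystem M) : HasDualSystem (Matrix.vecCons v M) := by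
  obtain ⟨g, hg, hgM⟩ := hM
  refine ⟨Matrix.vecCons f fun i => g i - (AddMonoidHom.mulLeft (g i v)).comp f,
    Fin.cases hf fun i => (hg i).sub (hf.mulLeft F.dy_dx ((hg i).constCoeff v)), ?_⟩
  refine Fin.cases (Fin.cases ?_ fun j => ?_) fun i => Fin.cases ?_ fun j => ?_
  · simpa using hv
  · simpa [(Fin.succ_ne_zero j).symm] using hfM j
  · simp [hv]
  · simp [hfM, hgM]

theorem HasDualSystem.single [IsDomain F.Elem] {M R : F.Op} {f : F.Op →+ F.Op}
    (hf : LODO.IsFunctional F.dy f) (hR : XOnly R) (hR0 : R ≠ 0) (h : f (M * R) = R) :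
    HasDualSystem fun _ : Fin 1 => M := by
  refine ⟨fun _ => f, fun _ => hf, fun i j => ?_⟩
  rw [if_pos (Subsingleton.elim i j)]
  refine mul_right_cancel₀ hR0 ?_
  rw [← hf.map_mul _ hR, h, one_mul]

/-- A functional whose value on a component is nonzero and of least possible order. -/
theorem exists_minimal_functional (hΩ : (Ω : Set (ℝ × ℝ)).Nonempty) {k : ℕ}
    (L : Fin (k + 1) → F.Op) (hL : L ≠ 0) :
    ∃ (v : F.Op) (T : Fin k → F.Op) (f : F.Op →+ F.Op),
      Relation.ReflTransGen AdmissibleStep L (Matrix.vecCons v T) ∧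
      LODO.IsFunctional F.dy f ∧ f v ≠ 0 ∧ (∀ j, f (T j) = 0) ∧
      (∀ g, LODO.IsFunctional F.dy g → ∃ c, XOnly c ∧ g v = c * f v) ∧
      ∀ g, LODO.IsFunctional F.dy g → g v = f v → ∀ j, ∃ s, XOnly s ∧ g (T j) = f v * s := by
  classical
  have hA := F.isField hΩ
  -- The minimum is taken over reachable rows and functionals together; a swap brings any component
  -- to the first place.
  have hex : ∃ m, ∃ L', Relation.ReflTransGen AdmissibleStep L L' ∧ ∃ f,
      LODO.IsFunctional F.dy f ∧ (f (L' 0)).OrderLT (m + 1) ∧ (f (L' 0)).coeff m ≠ 0 := by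
    obtain ⟨i, hi⟩ := Function.ne_iff.1 hL
    obtain ⟨f, hf, hfi⟩ := LODO.exists_functional_ne_zero hA F.dy_dx hi
    obtain ⟨m, hm⟩ := LODO.exists_order hfi
    refine ⟨m, _, .single (.swap L 0 i), f, hf, ?_⟩
    rwa [Function.comp_apply, Equiv.swap_apply_left]
  obtain ⟨L₁, hL₁, f, hf, hfm, hfm0⟩ := Nat.find_spec hex
  have hmin : ∀ L', Relation.ReflTransGen AdmissibleStep L L' → ∀ g, LODO.IsFunctional F.dy g →
      (g (L' 0)).OrderLT (Nat.find hex) → g (L' 0) = 0 := by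
    intro L' hL' g hg hlt
    by_contra h0
    obtain ⟨n, hn, hn0⟩ := LODO.exists_order h0
    exact Nat.find_min hex (m := n) (not_le.1 fun hle => hn0 (hlt n hle)) ⟨L', hL', g, hg, hn, hn0⟩
  generalize Nat.find hex = m at hfm hfm0 hmin
  clear hex
  obtain ⟨b, hb⟩ := hA.mul_inv_cancel hfm0
  obtain ⟨v, T, rfl⟩ : ∃ v T, L₁ = Matrix.vecCons v T :=
    ⟨_, _, (Matrix.cons_head_tail L₁).symm⟩
  rw [Matrix.cons_val_zero] at hfm hfm0 hb
  have hmin' : ∀ T' : Fin k → F.Op,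
      Relation.ReflTransGen AdmissibleStep L (Matrix.vecCons v T') → ∀ j s, XOnly s →
      ∀ g, LODO.IsFunctional F.dy g → (g (T' j) - g v * s).OrderLT m →
        g (T' j) - g v * s = 0 := by
    intro T' hT' j s hs g hg hlt
    have hs' := LODO.ConstCoeff.neg hs
    have hval : g (T' j + v * -s) = g (T' j) - g v * s := by
      rw [map_add, hg.map_mul _ hs', mul_neg, sub_eq_add_neg]
    -- Subtract `v * s` from the component and swap it to the front, so that minimality applies to
    -- the remainder.
    have := hmin _ ((hT'.trans (reflTransGen_add_mul v T' (fun _ => -s) fun _ => hs')).tail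
      (.swap _ 0 j.succ)) g hg
    rw [Function.comp_apply, Equiv.swap_apply_left, Matrix.cons_val_succ, hval] at this
    exact this hlt
  choose q hq hqT using fun j => LODO.exists_sub_mul_orderLT F.dy_dx (hf.constCoeff v) hfm hb
    (hf.constCoeff (T j))
  obtain ⟨T₁, hT₁, hfT₁⟩ : ∃ T₁ : Fin k → F.Op,
      Relation.ReflTransGen AdmissibleStep L (Matrix.vecCons v T₁) ∧ ∀ j, f (T₁ j) = 0 := by
    refine ⟨_, hL₁.trans (reflTransGen_add_mul v T (fun j => -q j) fun j =>
      LODO.ConstCoeff.neg (hq j)), fun j => ?_⟩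
    rw [map_add, hf.map_mul _ (LODO.ConstCoeff.neg (hq j)), mul_neg, ← sub_eq_add_neg]
    exact hmin' T hL₁ j (q j) (hq j) f hf (hqT j)
  refine ⟨v, T₁, f, hT₁, hf, fun h => hfm0 (by rw [h, LODO.coeff_zero]), hfT₁, fun g hg => ?_,
    fun g hg hgv j => ?_⟩
  · obtain ⟨c, hc, hlt⟩ := LODO.exists_sub_mul_orderLT' F.dy_dx (hf.constCoeff v) hfm hb
      (hg.constCoeff v)
    -- The remainder is the value at `v` of the functional `g - c f`, hence zero by minimality.
    exact ⟨c, hc, sub_eq_zero.1 (hmin _ hT₁ _ (hg.sub (hf.mulLeft F.dy_dx hc)) hlt)⟩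
  · obtain ⟨s, hs, hlt⟩ := LODO.exists_sub_mul_orderLT F.dy_dx (hf.constCoeff v) hfm hb
      (hg.constCoeff (T₁ j))
    -- Since `g v = f v`, the remainder is the value of `g` on `T₁ j - v * s`, which is again a
    -- reachable component.
    rw [← hgv] at hlt
    exact ⟨s, hs, by rw [← hgv]; exact sub_eq_zero.1 (hmin' T₁ hT₁ j s hs g hg hlt)⟩

theorem exists_reduction (hΩ : (Ω : Set (ℝ × ℝ)).Nonempty)
    (hF : ∃ a : F.Elem, F.dy a = 0 ∧ F.dx a ≠ 0) {k : ℕ} (L : Fin k → F.Op) (hL : L ≠ 0) :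
    ∃ (L' : Fin k → F.Op) (n : ℕ) (M : Fin (n + 1) → F.Op) (R : F.Op),
      Relation.ReflTransGen AdmissibleStep L L' ∧ XOnly R ∧ R ≠ 0 ∧
      DropZeros L'
        (Fin.snoc (α := fun _ => F.Op) (fun i : Fin n => M i.castSucc) (M (Fin.last n) * R)) ∧
      HasDualSystem M := by
  have hA := F.isField hΩ
  have := hA.isDomain
  have := F.charZero hΩ
  induction k with
  | zero => exact absurd (Subsingleton.elim _ _) hL
  | succ k ih =>
  obtain ⟨v, T, f, hT, hf, hd0, hfT, hleft, hright⟩ := exists_minimal_functional hΩ L hL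
  by_cases hT0 : T = 0
  · subst hT0
    obtain ⟨κ, _, e, g, -, hg, hv⟩ :=
      LODO.exists_functional_expansion hA F.dy_dx (fun _ : Unit => v)
    choose c hc hcv using fun s => hleft (g s) (hg s)
    -- Every coordinate of `v` is a left multiple of `f v`, so `f v` can be factored out of the
    -- whole expansion.
    obtain ⟨P, hP⟩ : ∃ P, P * f v = v := by
      refine ⟨∑ s, LODO.C (e s) * c s, ?_⟩
      rw [Finset.sum_mul]
      conv_rhs => rw [hv ()]
      exact Finset.sum_congr rfl fun s _ => by rw [hcv, mul_assoc]
    have hdual := HasDualSystem.single hf (hf.constCoeff v) hd0 (congrArg f hP)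
    have hdrop := dropZeros_single (k := k) v (M := fun _ => P) hP
    exact ⟨_, 0, fun _ => P, f v, hT, hf.constCoeff v, hd0, hdrop, hdual⟩
  · obtain ⟨s, hs, hds⟩ : ∃ s, XOnly s ∧ f v * s = 1 := by
      obtain ⟨a, ha, ha'⟩ := hF
      obtain ⟨j, hj⟩ := Function.ne_iff.1 hT0
      obtain ⟨g, hg, hgj⟩ := LODO.exists_functional_ne_zero hA F.dy_dx hj
      obtain ⟨c, hc, hcv⟩ := hleft g hg
      refine LODO.exists_mul_eq_one_of_forall_mul_mem hA F.dy_dx ha ha' (hg.constCoeff _) hgj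
        fun r hr => ?_
      -- The functional `f + r (g - c f)` agrees with `f` on `v`, and on `T j` equals `r g(T j)`
      -- because `f (T j) = 0`.
      obtain ⟨s, hs, h⟩ := hright _ (hf.add ((hg.sub (hf.mulLeft F.dy_dx hc)).mulLeft F.dy_dx hr))
        (show f v + r * (g v - c * f v) = f v by rw [hcv, sub_self, mul_zero, add_zero]) j
      refine ⟨s, hs, ?_⟩
      rw [← h]
      change r * g (T j) = f (T j) + r * (g (T j) - c * f (T j))
      rw [hfT, mul_zero, sub_zero, zero_add]
    -- The functional `s f` takes the value `1` at `v`, so the left inverse is needed as well.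
    have hsd : s * f v = 1 := by
      refine mul_left_cancel₀ hd0 ?_
      rw [← mul_assoc, hds, one_mul, mul_one]
    obtain ⟨T', n, M, R, hTT', hR, hR0, hdrop, hM⟩ := ih T hT0
    refine ⟨_, n + 1, Matrix.vecCons v M, R, hT.trans (reflTransGen_vecCons v hTT'), hR, hR0,
      hdrop.vecCons v, HasDualSystem.vecCons (hf.mulLeft F.dy_dx hs) hsd (fun j => ?_) hM⟩
    have hfT' := functional_eq_zero_of_reflTransGen hf hTT' hfT
    obtain ⟨e, he, -⟩ := hdrop
    suffices h : f (M j) = 0 by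
      rw [AddMonoidHom.comp_apply, h, map_zero]
    refine Fin.lastCases ?_ (fun i => ?_) j
    · have := he (Fin.last n)
      rw [Fin.snoc_last] at this
      -- Only the product of the last component with `R` occurs in the row, so `R` has to be
      -- cancelled.
      refine mul_right_cancel₀ hR0 ?_
      rw [← hf.map_mul _ hR, this, hfT', zero_mul]
    · have := he i.castSucc
      rw [Fin.snoc_castSucc] at this
      rw [this, hfT']

end PlaneFunctionField

/-! ### The theorem -/

theorem mainTheorem9 {𝕜 : Type} [RCLike 𝕜] (Ω : TopologicalSpace.Opens (ℝ × ℝ))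
    (hΩ : (Ω : Set (ℝ × ℝ)).Nonempty) (F : PlaneFunctionField 𝕜 Ω)
    (hF : ∃ a : F.Elem, F.dy a = 0 ∧ F.dx a ≠ 0)
    (k : ℕ) (hk : 0 < k) (L : Fin k → F.Op) :
    ∃ (L' : Fin k → F.Op) (n : ℕ) (M : Fin (n + 1) → F.Op) (R : F.Op),
      Relation.ReflTransGen PlaneFunctionField.AdmissibleStep L L' ∧
      PlaneFunctionField.XOnly R ∧
      (L ≠ 0 → R ≠ 0) ∧
      PlaneFunctionField.DropZeros L'
        (Fin.snoc (α := fun _ => F.Op) (fun i : Fin n => M i.castSucc) (M (Fin.last n) * R)) ∧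
      ¬ PlaneFunctionField.OperatorReducible M ∧
      PlaneFunctionField.KernelIrreducible M := by
  by_cases hL : L = 0
  · subst hL
    have := F.isField hΩ |>.isDomain
    -- For the zero row any irreducible row of length one serves, with `R = 0`; one is obtained by
    -- reducing the row `(1)`, where dropping components forces `n = 0`.
    obtain ⟨-, n, M, -, -, -, -, ⟨e, -⟩, hM⟩ := PlaneFunctionField.exists_reduction hΩ hF
      (fun _ : Fin 1 => (1 : F.Op)) (fun h => one_ne_zero (congrFun h 0))
    obtain rfl : n = 0 := by
      have := Fintype.card_le_of_injective e e.injective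
      rw [Fintype.card_fin, Fintype.card_fin] at this
      omega
    refine ⟨0, 0, M, 0, .refl, LODO.ConstCoeff.zero, fun h => absurd rfl h,
      ⟨Fin.castLEOrderEmb hk, fun i => ?_, fun _ _ => rfl⟩, hM.not_operatorReducible hΩ,
      hM.kernelIrreducible hΩ⟩
    obtain rfl : i = Fin.last 0 := Fin.fin_one_eq_zero i
    rw [Fin.snoc_last, mul_zero]
    rfl
  · obtain ⟨L', n, M, R, hLL', hR, hR0, hdrop, hM⟩ :=
      PlaneFunctionField.exists_reduction hΩ hF L hL
    exact ⟨L', n, M, R, hLL', hR, fun _ => hR0, hdrop, hM.not_operatorReducible hΩ,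
      hM.kernelIrreducible hΩ⟩
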